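/- Let $(a_i)_{i\ge 1}$ be nonzero integers such that for every integer $l\ge 1$ one has $|a_{i+1}|>|a_i|^{i^l}$ for all sufficiently large $i$ (so that $H(x)=\sum_{i\ge1}x^i/a_i$ is a Liouville function), and put $H_k(x)=\sum_{i=1}^{k}x^i/a_i$. Let $\phi(x_1,\dots,x_n,y_1,\dots,y_n,\overline z)$ be a conjunction of polynomial equations with rational coefficients, where $\overline z$ is a finite tuple of parameters, and for a value $\overline z$ in $\mathbb{C}$ let $V_{\overline z}\subseteq\mathbb{C}^{2n}$ be the algebraic set defined by $\phi(\cdot,\cdot,\overline z)$. Suppose that $\overline z$ satisfies the following condition $\theta(\overline z)$: (i) $V_{\overline z}$ is irreducible, has dimension $n$, and is not contained in a subspace $x_i=x_j$ with $i\ne j$ nor in a subspace $x_i=c$ with $c\in\mathbb{C}$; (ii) one can choose for every $i\in\{1,\dots,n\}$ a variable $u_i\in\{x_i,y_i\}$ such that the subset of $\mathbb{C}^n$ defined by $\exists u_1\cdots\exists u_n\,\phi(\overline x,\overline y,\overline z)$, i.e. the projection of $V_{\overline z}$ to the other $n$ variables, is Zariski dense in $\mathbb{C}^n$. Let $r$ be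 the transcendence degree of $\mathbb{Q}(\overline z)$ over $\mathbb{Q}$, let $k\ge 0$ and $d\ge n(nr+n+r+1)$ be integers, let $g_d(x)=\sum_{i=1}^{d}\alpha_i x^i$ where $\alpha_1,\dots,\alpha_d\in\mathbb{C}$ are algebraically independent over $\mathbb{Q}$, and let $\mu_{k,d}(x)=H_k(x)+x^k g_d(x)$, applied to tuples componentwise. Then there is $\overline x\in\mathbb{C}^n$ such that $(\overline x,\mu_{k,d}(\overline x))$ is a generic point of $V_{\overline z}$ over $\mathbb{Q}(\overline z)$, that is, a point of $V_{\overline z}$ of transcendence degree $n$ over $\mathbb{Q}(\overline z)$. Moreover, whenever $(\overline x,\mu_{k,d}(\overline x))$ is such a generic point, the components of $\overline x$ are nonzero and pairwise distinct. -/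

import Mathlib

open MvPolynomial

noncomputable section

/-- The Zariski topology on the affine space `K^σ`: the closed sets are the zero loci of ideals
of polynomials with coefficients in `K`. -/
abbrev zariskiTopology (K σ : Type*) [Field K] : TopologicalSpace (σ → K) :=
  TopologicalSpace.ofClosed
    {Z : Set (σ → K) | ∃ I : Ideal (MvPolynomial σ K), Z = zeroLocus K I}
    ⟨⊤, by simp⟩
    (by
      intro A hA
      refine ⟨sSup {I : Ideal (MvPolynomial σ K) | zeroLocus K I ∈ A}, Set.ext fun x => ?_⟩
      have hx : ∀ I : Ideal (MvPolynomial σ K),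
          x ∈ zeroLocus K I ↔ I ≤ vanishingIdeal K {x} := fun I => by
        rw [← le_zeroLocus_iff_le_vanishingIdeal]
        exact Set.singleton_subset_iff.symm
      rw [hx, sSup_le_iff]
      constructor
      · intro h I hI
        exact (hx I).1 (h _ hI)
      · intro h Z hZ
        obtain ⟨I, rfl⟩ := hA hZ
        exact (hx I).2 (h I hZ))
    (by
      rintro _ ⟨I, rfl⟩ _ ⟨J, rfl⟩
      refine ⟨I * J, Set.ext fun x => ?_⟩
      have hx : ∀ I : Ideal (MvPolynomial σ K),
          x ∈ zeroLocus K I ↔ I ≤ vanishingIdeal K {x} := fun I => by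
        rw [← le_zeroLocus_iff_le_vanishingIdeal]
        exact Set.singleton_subset_iff.symm
      have hp : (vanishingIdeal K {x}).IsPrime := inferInstance
      rw [Set.mem_union, hx, hx, hx, hp.mul_le])

/-- `V ⊆ K^σ` is irreducible in the Zariski topology (in particular nonempty). -/
def IsZariskiIrreducible {K σ : Type*} [Field K] (V : Set (σ → K)) : Prop :=
  @IsIrreducible _ (zariskiTopology K σ) V

/-- `S ⊆ K^σ` is dense in the Zariski topology. -/
def IsZariskiDense {K σ : Type*} [Field K] (S : Set (σ → K)) : Prop :=
  @Dense _ (zariskiTopology K σ) S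

/-- The dimension of `V ⊆ K^σ`: the Krull dimension of `V` with the topology induced by the
Zariski topology. -/
def zariskiDim {K σ : Type*} [Field K] (V : Set (σ → K)) : WithBot ℕ∞ :=
  @topologicalKrullDim V
    (TopologicalSpace.induced (Subtype.val : V → (σ → K)) (zariskiTopology K σ))

/-- The algebraic set `V_z ⊆ ℂ^{2n}` of all points `(x, y)` with `p(x, y, z) = 0` for all `p` in
the finite set `Φ` of polynomials with rational coefficients. The coordinate `x_i` of a point `v`
is `v (Sum.inl i)` and `y_i` is `v (Sum.inr i)`. -/
def paramVariety {n m : ℕ} (Φ : Finset (MvPolynomial ((Fin n ⊕ Fin n) ⊕ Fin m) ℚ))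
    (z : Fin m → ℂ) : Set (Fin n ⊕ Fin n → ℂ) :=
  {v | ∀ p ∈ Φ, aeval (Sum.elim v z) p = 0}

/-- `V ⊆ ℂ^{2n}` is irreducible, of dimension `n`, and contained neither in a subspace `x_i = x_j`
with `i ≠ j` nor in a subspace `x_i = c`. -/
structure ConditionXi {n : ℕ} (V : Set (Fin n ⊕ Fin n → ℂ)) : Prop where
  irreducible : IsZariskiIrreducible V
  dim_eq : zariskiDim V = n
  not_subset_diag : ∀ i j : Fin n, i ≠ j → ¬ V ⊆ {v | v (Sum.inl i) = v (Sum.inl j)}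
  not_subset_const : ∀ (i : Fin n) (c : ℂ), ¬ V ⊆ {v | v (Sum.inl i) = c}

/-- The projection of `V` to `ℂⁿ` that forgets, for every `i`, the variable `u_i ∈ {x_i, y_i}`
chosen by `ε` (`x_i` if `ε i = true`, `y_i` if `ε i = false`) and keeps the other one. -/
def chosenProjection {n : ℕ} (V : Set (Fin n ⊕ Fin n → ℂ)) (ε : Fin n → Bool) :
    Set (Fin n → ℂ) :=
  (fun v i => if ε i then v (Sum.inr i) else v (Sum.inl i)) '' V

/-- For at least one of the `2^n` choices, the projection of `V` is Zariski dense in `ℂⁿ`. -/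
def ConditionPsi {n : ℕ} (V : Set (Fin n ⊕ Fin n → ℂ)) : Prop :=
  ∃ ε : Fin n → Bool, IsZariskiDense (chosenProjection V ε)

/-- The condition `θ(z)`. -/
def ConditionTheta {n m : ℕ} (Φ : Finset (MvPolynomial ((Fin n ⊕ Fin n) ⊕ Fin m) ℚ))
    (z : Fin m → ℂ) : Prop :=
  ConditionXi (paramVariety Φ z) ∧ ConditionPsi (paramVariety Φ z)

/-- The field `ℚ(z)`. -/
abbrev paramField {m : ℕ} (z : Fin m → ℂ) : IntermediateField ℚ ℂ :=
  IntermediateField.adjoin ℚ (Set.range z)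

/-- `v` is a point of `V` whose coordinates generate an extension of `F` of transcendence
degree `n`. For `V` of dimension `n` defined over `F` this is a generic point of `V` over `F`. -/
def IsGenericPointOver {n : ℕ} (F : IntermediateField ℚ ℂ) (V : Set (Fin n ⊕ Fin n → ℂ))
    (v : Fin n ⊕ Fin n → ℂ) : Prop :=
  v ∈ V ∧ Algebra.trdeg F (IntermediateField.adjoin F (Set.range v)) = n

/-- The integers `a i`, `i ≥ 1`, are the denominators of a Liouville function
`H(x) = ∑_{i ≥ 1} x^i / a_i` (the value `a 0` plays no role). -/
structure IsLiouvilleSequence (a : ℕ → ℤ) : Prop where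
  ne_zero : ∀ i, 1 ≤ i → a i ≠ 0
  growth : ∀ l : ℕ, 1 ≤ l → ∀ᶠ i in Filter.atTop, |a i| ^ (i ^ l) < |a (i + 1)|

/-- The partial sum `H_k(x) = ∑_{i=1}^k x^i / a_i`. -/
def liouvillePartialSum (a : ℕ → ℤ) (k : ℕ) (x : ℂ) : ℂ :=
  ∑ i ∈ Finset.Icc 1 k, x ^ i / (a i : ℂ)

/-- The polynomial function `x ↦ ∑_{i=1}^d α_i x^i`; here `α_i` is `α j` with `j = i - 1`. -/
def polyOfCoeffs {d : ℕ} (α : Fin d → ℂ) (x : ℂ) : ℂ :=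
  ∑ j : Fin d, α j * x ^ ((j : ℕ) + 1)

/-- `g` is a generic polynomial (function) of degree `d`: `g(x) = ∑_{i=1}^d α_i x^i` with
coefficients `α_i` that are algebraically independent over `ℚ`. -/
def IsGenericPolynomial (d : ℕ) (g : ℂ → ℂ) : Prop :=
  ∃ α : Fin d → ℂ, AlgebraicIndependent ℚ α ∧ g = polyOfCoeffs α

/-- The modified partial sum `μ_{k,d}(x) = H_k(x) + x^k g(x)`, where `g = g_d`. -/
def modifiedPartialSum (a : ℕ → ℤ) (k : ℕ) (g : ℂ → ℂ) (x : ℂ) : ℂ :=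
  liouvillePartialSum a k x + x ^ k * g x

end

/-! Let K = ℚ(z) and write μ = g₀ + q·h with g₀ = H_k and q = X^(k+1) over K, and h = ∑ α_(j+1) X^j
of degree < d. Wanted is a K-generic point of V with y_i = g₀(x_i) + q(x_i) h(x_i). The coefficients
of h are independent over ℚ, so over K their transcendence degree is at least d - r: there are at
most r "relations". Let d = n + m.

Independent coefficients over K (`exists_generic_interpolation`): take a generic point (x, y) in the
function field of V. The polynomials of degree < n + m with the required values at the n distinct
nodes x_i have m free parameters; make these independent variables. The coefficients then lie in a
field of transcendence degree n + m, and they are independent as soon as this field is algebraic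
over them, that is, as soon as every derivation D killing them is zero. For such D, D y_i = s_i D
x_i with s_i the slope at x_i. Expressed in the transcendence basis given by the dense projection,
this is a square linear system, and for m ≥ n the slopes are generic enough to make its determinant
nonzero. Since independent tuples are conjugate, every h with independent coefficients has a generic
solution (`exists_isGenericOver_solution`).

General h (`exists_isGenericOver_or_exists_reduction`): deform h along a parameter t to independent
coefficients, solve, and let t tend to 0 along a place. Let K' be the residue field of E = K(x, y).
If it has transcendence degree at least n over K, the place embeds E and the limit is a generic
solution. Otherwise, as the remainder of the deformed polynomial modulo ∏ (X - x_i) has coefficients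
in E, the limit gives h = Q + w·h₁ with Q, w over K', w ≠ 0 and deg h₁ < m. Passing to K' and h₁
loses n coefficients but less than n in transcendence degree, so the number of relations drops. The
induction (`exists_isGenericOver_of_le_trdeg_coeff`) needs only d ≥ n(r+2).

At a generic point every x_i is transcendental over K and no equation x_i = x_j holds, because V
satisfies none of the excluded linear conditions. -/

noncomputable section

/-! ### Zariski topology, prime ideals and dimension -/

section Zariski

variable {K σ : Type*} [Field K]

theorem isClosed_zariskiTopology_iff {Z : Set (σ → K)} :
    @IsClosed _ (zariskiTopology K σ) Z ↔ ∃ I : Ideal (MvPolynomial σ K), Z = zeroLocus K I := by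
  rw [← @isOpen_compl_iff _ _ (zariskiTopology K σ)]
  change Zᶜᶜ ∈ _ ↔ _
  rw [compl_compl]
  rfl

theorem vanishingIdeal_isPrime_iff_irreducible {V : Set (σ → K)} :
    (vanishingIdeal K V).IsPrime ↔ IsZariskiIrreducible V := by
  let _ := zariskiTopology K σ
  constructor
  · intro hP
    refine ⟨?_, ?_⟩
    · by_contra hV
      rw [Set.not_nonempty_iff_eq_empty] at hV
      apply hP.ne_top
      rw [hV, vanishingIdeal_empty]
    · rw [isPreirreducible_iff_isClosed_union_isClosed]
      intro Z₁ Z₂ h₁ h₂ hV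
      obtain ⟨I, rfl⟩ := isClosed_zariskiTopology_iff.1 h₁
      obtain ⟨J, rfl⟩ := isClosed_zariskiTopology_iff.1 h₂
      have hIJ : I * J ≤ vanishingIdeal K V := by
        rw [Ideal.mul_le]
        intro f hf g hg v hv
        rw [map_mul]
        rcases hV hv with h | h
        · rw [h f hf, zero_mul]
        · rw [h g hg, mul_zero]
      rcases hP.mul_le.1 hIJ with h | h
      · exact Or.inl (le_zeroLocus_iff_le_vanishingIdeal.2 h)
      · exact Or.inr (le_zeroLocus_iff_le_vanishingIdeal.2 h)
  · intro hV
    have hV' : IsIrreducible V := hV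
    rw [Ideal.isPrime_iff]
    constructor
    · rw [Ideal.ne_top_iff_one]
      intro h
      obtain ⟨v, hv⟩ := hV'.nonempty
      simpa using h v hv
    · intro f g hfg
      have key := isPreirreducible_iff_isClosed_union_isClosed.1 hV'.isPreirreducible
        (zeroLocus K (Ideal.span {f})) (zeroLocus K (Ideal.span {g}))
        (isClosed_zariskiTopology_iff.2 ⟨_, rfl⟩) (isClosed_zariskiTopology_iff.2 ⟨_, rfl⟩)
        (by
          intro v hv
          have := hfg v hv
          rw [map_mul, mul_eq_zero] at this
          simpa [zeroLocus_span] using this)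
      simpa [zeroLocus_span, Set.subset_def] using key

theorem isIrreducible_image_val_iff {X : Type*} [TopologicalSpace X] {V : Set X} {Z : Set V} :
    IsIrreducible (Subtype.val '' Z) ↔ IsIrreducible Z := by
  refine ⟨fun h => ⟨by simpa using h.nonempty, ?_⟩, fun h => h.image _ continuous_subtype_val.continuousOn⟩
  intro U W hU hW hZU hZW
  obtain ⟨U', hU', rfl⟩ := isOpen_induced_iff.1 hU
  obtain ⟨W', hW', rfl⟩ := isOpen_induced_iff.1 hW
  obtain ⟨u, hu, hu'⟩ := hZU
  obtain ⟨w, hw, hw'⟩ := hZW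
  obtain ⟨_, ⟨x, hx, rfl⟩, hx'⟩ := h.isPreirreducible U' W' hU' hW' ⟨u, ⟨u, hu, rfl⟩, hu'⟩ ⟨w, ⟨w, hw, rfl⟩, hw'⟩
  exact ⟨x, hx, hx'⟩

theorem zeroLocus_vanishingIdeal_of_eq {V : Set (σ → K)} {I : Ideal (MvPolynomial σ K)}
    (h : V = zeroLocus K I) : zeroLocus K (vanishingIdeal K V) = V := by
  refine le_antisymm ?_ (zeroLocus_vanishingIdeal_le V)
  conv_rhs => rw [h]
  exact zeroLocus_anti_mono (le_zeroLocus_iff_le_vanishingIdeal.1 h.le)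

/-- By the Nullstellensatz, irreducible closed subsets of V correspond, with order reversed, to the
primes containing the ideal of V. -/
theorem zariskiDim_eq_ringKrullDim [IsAlgClosed K] [Finite σ] {V : Set (σ → K)}
    (hV : zeroLocus K (vanishingIdeal K V) = V) :
    zariskiDim V = ringKrullDim (MvPolynomial σ K ⧸ vanishingIdeal K V) := by
  let _ := zariskiTopology K σ
  rw [ringKrullDim_quotient]
  have hclosed : ∀ Z : TopologicalSpace.IrreducibleCloseds V,
      zeroLocus K (vanishingIdeal K (Subtype.val '' (Z : Set V))) = Subtype.val '' (Z : Set V) := by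
    intro Z
    have hVc : IsClosed V := isClosed_zariskiTopology_iff.2 ⟨_, hV.symm⟩
    have : IsClosed (Subtype.val '' (Z : Set V)) := hVc.isClosedMap_subtype_val _ Z.isClosed
    obtain ⟨I, hI⟩ := isClosed_zariskiTopology_iff.1 this
    exact zeroLocus_vanishingIdeal_of_eq hI
  let f : TopologicalSpace.IrreducibleCloseds V →
      (PrimeSpectrum.zeroLocus (R := MvPolynomial σ K) (vanishingIdeal K V))ᵒᵈ := fun Z =>
    OrderDual.toDual ⟨⟨vanishingIdeal K (Subtype.val '' (Z : Set V)),
      vanishingIdeal_isPrime_iff_irreducible.2 (isIrreducible_image_val_iff.2 Z.isIrreducible)⟩,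
      vanishingIdeal_anti_mono (by rintro _ ⟨v, -, rfl⟩; exact v.2)⟩
  have hpre : ∀ P : PrimeSpectrum.zeroLocus (R := MvPolynomial σ K) (vanishingIdeal K V),
      Subtype.val '' (Subtype.val ⁻¹' (zeroLocus K P.1.asIdeal) : Set V)
        = zeroLocus K P.1.asIdeal := by
    intro P
    rw [Subtype.image_preimage_coe, Set.inter_eq_right]
    exact (zeroLocus_anti_mono P.2).trans hV.le
  let g : (PrimeSpectrum.zeroLocus (R := MvPolynomial σ K) (vanishingIdeal K V))ᵒᵈ →
      TopologicalSpace.IrreducibleCloseds V := fun P =>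
    ⟨Subtype.val ⁻¹' (zeroLocus K (OrderDual.ofDual P).1.asIdeal),
      by
        rw [← isIrreducible_image_val_iff, hpre]
        apply vanishingIdeal_isPrime_iff_irreducible.1
        have := (OrderDual.ofDual P).1.isPrime
        rw [IsPrime.vanishingIdeal_zeroLocus]
        exact this,
      (isClosed_zariskiTopology_iff.2 ⟨_, rfl⟩ : IsClosed (zeroLocus K _)).preimage
        continuous_subtype_val⟩
  have hf : Monotone f := fun Z W h => vanishingIdeal_anti_mono (Set.image_mono h)
  have hg : Monotone g := fun P Q h =>
    Set.preimage_mono (f := Subtype.val) (zeroLocus_anti_mono (K := K)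
      (I := (OrderDual.ofDual Q).1.asIdeal) (J := (OrderDual.ofDual P).1.asIdeal) h)
  have hgf : ∀ Z, g (f Z) = Z := by
    intro Z
    apply TopologicalSpace.IrreducibleCloseds.ext
    change Subtype.val ⁻¹' (zeroLocus K (vanishingIdeal K (Subtype.val '' (Z : Set V)))) = (Z : Set V)
    rw [hclosed, Set.preimage_image_eq _ Subtype.val_injective]
  have hfg : ∀ P, f (g P) = P := by
    intro P
    apply OrderDual.ofDual.injective
    apply Subtype.ext
    apply PrimeSpectrum.ext
    change vanishingIdeal K (Subtype.val '' (Subtype.val ⁻¹'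
      (zeroLocus K (OrderDual.ofDual P).1.asIdeal) : Set V)) = _
    rw [hpre]
    have := (OrderDual.ofDual P).1.isPrime
    rw [IsPrime.vanishingIdeal_zeroLocus]
  have e : TopologicalSpace.IrreducibleCloseds V ≃o
      (PrimeSpectrum.zeroLocus (R := MvPolynomial σ K) (vanishingIdeal K V))ᵒᵈ :=
    Equiv.toOrderIso ⟨f, g, hgf, hfg⟩ hf hg
  have := Order.krullDim_eq_of_orderIso e
  rw [Order.krullDim_orderDual] at this
  exact this

end Zariski

/-! ### Integral extensions and injectivity by transcendence degree -/

section IntegralDim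

theorem ringKrullDim_eq_of_isIntegral {R S : Type*} [CommRing R] [CommRing S] [IsDomain R]
    [IsDomain S] [Algebra R S] [Algebra.IsIntegral R S]
    (hinj : Function.Injective (algebraMap R S)) : ringKrullDim S = ringKrullDim R := by
  apply le_antisymm
  · refine Order.krullDim_le_of_strictMono (PrimeSpectrum.comap (algebraMap R S)) ?_
    intro P Q h
    exact Ideal.IsIntegral.comap_lt_comap (R := R) (A := S) (I := P.asIdeal) (J := Q.asIdeal) h
  · refine iSup_le fun l => ?_
    obtain ⟨Q, hQ, hQl⟩ := Ideal.exists_ideal_over_prime_of_isIntegral_of_isDomain (S := S)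
      (RelSeries.head l).asIdeal (by
        rw [(RingHom.injective_iff_ker_eq_bot _).1 hinj]; exact bot_le)
    have : Q.LiesOver (RelSeries.head l).asIdeal := ⟨hQl.symm⟩
    obtain ⟨L, hL, -⟩ := Ideal.exists_ltSeries_of_hasGoingUp l Q
    rw [← hL]
    exact le_iSup (fun p : LTSeries (PrimeSpectrum S) => ((p.length : ℕ∞) : WithBot ℕ∞)) L

end IntegralDim

section Specialization

/-- S is algebraic over K[a], so a nonzero element of the kernel would divide a nonzero element of
K[a], on which φ is injective. -/
theorem injective_of_algebraicIndependent_comp {K S F ι : Type*} [Field K] [CommRing S] [IsDomain S]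
    [CommRing F] [Algebra K S] [Algebra K F] [Finite ι] (φ : S →ₐ[K] F) (a : ι → S)
    (ha : AlgebraicIndependent K (φ ∘ a))
    (h : Algebra.trdeg K S ≤ Nat.card ι) :
    Function.Injective φ := by
  have ha' : AlgebraicIndependent K a := ha.of_comp φ
  have hb := (ha'.isTranscendenceBasis_of_lift_trdeg_le_of_finite (by
    rw [← Nat.cast_card (α := ι), Cardinal.lift_natCast]
    simpa using h)).isAlgebraic
  rw [injective_iff_map_eq_zero]
  intro s hs
  by_contra hs0
  obtain ⟨r, hr, hdvd⟩ := (hb.isAlgebraic s).exists_nonzero_dvd (mem_nonZeroDivisors_of_ne_zero hs0)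
  obtain ⟨r, hr'⟩ := r
  rw [Algebra.adjoin_range_eq_range_aeval] at hr'
  obtain ⟨p, rfl⟩ := hr'
  obtain ⟨b, hb⟩ := hdvd
  have h1 : φ (aeval a p) = 0 := by
    have : aeval a p = s * b := hb
    rw [this, map_mul, hs, zero_mul]
  rw [← AlgHom.comp_apply, MvPolynomial.comp_aeval] at h1
  have h2 : p = 0 := (injective_iff_map_eq_zero _).1 ha p h1
  apply hr
  ext
  simp [h2]

end Specialization
end

noncomputable section

section IntegralLift

/-- Choose a prime of S over the kernel of f, then extend from R/ker f to the integral extension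
S/Q. This lifts points along a Noether normalization. -/
theorem exists_ringHom_comp_algebraMap_eq {R S M : Type*} [CommRing R] [CommRing S] [IsDomain S]
    [Algebra R S] [Algebra.IsIntegral R S] [Field M] [IsAlgClosed M]
    (hinj : Function.Injective (algebraMap R S)) (f : R →+* M) :
    ∃ g : S →+* M, g.comp (algebraMap R S) = f := by
  have : (RingHom.ker f).IsPrime := RingHom.ker_isPrime f
  obtain ⟨Q, hQ, hQf⟩ := Ideal.exists_ideal_over_prime_of_isIntegral_of_isDomain (S := S)
    (RingHom.ker f) (by rw [(RingHom.injective_iff_ker_eq_bot _).1 hinj]; exact bot_le)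
  have : Q.LiesOver (RingHom.ker f) := ⟨hQf.symm⟩
  let _ : Algebra (R ⧸ RingHom.ker f) M := (RingHom.kerLift f).toAlgebra
  have : Module.IsTorsionFree (R ⧸ RingHom.ker f) M :=
    Module.isTorsionFree_iff_algebraMap_injective.2 (RingHom.kerLift_injective f)
  have : Module.IsTorsionFree (R ⧸ RingHom.ker f) (S ⧸ Q) := by
    rw [Module.isTorsionFree_iff_algebraMap_injective, injective_iff_map_eq_zero]
    intro a
    obtain ⟨a, rfl⟩ := Ideal.Quotient.mk_surjective a
    rw [Ideal.Quotient.algebraMap_mk_of_liesOver, Ideal.Quotient.eq_zero_iff_mem,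
      Ideal.Quotient.eq_zero_iff_mem, ← hQf]
    exact id
  have : Algebra.IsIntegral (R ⧸ RingHom.ker f) (S ⧸ Q) := by
    refine ⟨fun b => ?_⟩
    obtain ⟨b, rfl⟩ := Ideal.Quotient.mk_surjective b
    obtain ⟨p, hp, hpb⟩ := Algebra.IsIntegral.isIntegral (R := R) b
    refine ⟨p.map (Ideal.Quotient.mk _), hp.map _, ?_⟩
    have h2 : (algebraMap (R ⧸ RingHom.ker f) (S ⧸ Q)).comp (Ideal.Quotient.mk _)
        = (Ideal.Quotient.mk Q).comp (algebraMap R S) := by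
      ext; rfl
    rw [Polynomial.eval₂_map, h2, ← Polynomial.hom_eval₂, hpb, map_zero]
  let g : S ⧸ Q →ₐ[R ⧸ RingHom.ker f] M := IsAlgClosed.lift
  refine ⟨(g : S ⧸ Q →+* M).comp (Ideal.Quotient.mk Q), ?_⟩
  ext a
  exact g.commutes (Ideal.Quotient.mk _ a)

end IntegralLift

/-! ### Generic points and transcendence degree -/

section Generic

variable {K Ω σ : Type*} [Field K] [Field Ω] [Algebra K Ω]

/-- `v` is a generic point of `V` over `K`: the polynomials over `K` that vanish at `v` are those
that vanish on `V`. -/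
def IsGenericOver (K : Type*) {Ω E σ : Type*} [Field K] [Field Ω] [Algebra K Ω] [Field E]
    [Algebra K E] (V : Set (σ → Ω)) (v : σ → E) : Prop :=
  ∀ f : MvPolynomial σ K, aeval v f = 0 ↔ f ∈ vanishingIdeal K V

/-- `V` is defined by polynomial equations over `K`. -/
def IsDefinedOver (K : Type*) {Ω σ : Type*} [Field K] [Field Ω] [Algebra K Ω]
    (V : Set (σ → Ω)) : Prop :=
  zeroLocus Ω (vanishingIdeal K V) = V

theorem map_mem_vanishingIdeal_iff {V : Set (σ → Ω)} (K' : Type*) [Field K'] [Algebra K K']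
    [Algebra K' Ω] [IsScalarTower K K' Ω] {f : MvPolynomial σ K} :
    map (algebraMap K K') f ∈ vanishingIdeal K' V ↔ f ∈ vanishingIdeal K V := by
  simp only [mem_vanishingIdeal_iff, aeval_map_algebraMap]

theorem vanishingIdeal_isPrime (K : Type*) [Field K] [Algebra K Ω] {V : Set (σ → Ω)}
    (hV : IsZariskiIrreducible V) : (vanishingIdeal K V).IsPrime := by
  have h := vanishingIdeal_isPrime_iff_irreducible.2 hV
  have : vanishingIdeal K V = (vanishingIdeal Ω V).comap (map (algebraMap K Ω)) := by
    ext f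
    rw [Ideal.mem_comap, map_mem_vanishingIdeal_iff]
  rw [this]
  exact h.comap _

theorem IsDefinedOver.extend {V : Set (σ → Ω)} (h : IsDefinedOver K V) (K' : Type*) [Field K']
    [Algebra K K'] [Algebra K' Ω] [IsScalarTower K K' Ω] : IsDefinedOver K' V := by
  refine le_antisymm ?_ (zeroLocus_vanishingIdeal_le V)
  refine le_trans ?_ h.le
  intro v hv f hf
  have := hv _ ((map_mem_vanishingIdeal_iff K').2 hf)
  rwa [aeval_map_algebraMap] at this

theorem IsGenericOver.restrict {V : Set (σ → Ω)} {K' E : Type*} [Field K']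
    [Algebra K K'] [Algebra K' Ω] [IsScalarTower K K' Ω] [Field E] [Algebra K' E] [Algebra K E]
    [IsScalarTower K K' E] {v : σ → E} (h : IsGenericOver K' V v) : IsGenericOver K V v := by
  intro f
  rw [← map_mem_vanishingIdeal_iff K', ← h, aeval_map_algebraMap]

theorem IsGenericOver.mem {V : Set (σ → Ω)} {v : σ → Ω} (h : IsGenericOver K V v)
    (hV : IsDefinedOver K V) : v ∈ V := by
  rw [← hV]
  exact fun f hf => (h f).2 hf

theorem IsGenericOver.map_algHom {V : Set (σ → Ω)} {S F : Type*} [Field S] [Algebra K S]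
    [Field F] [Algebra K F] {v : σ → S} (h : IsGenericOver K V v) (φ : S →ₐ[K] F) :
    IsGenericOver K V (φ ∘ v) := by
  intro f
  change aeval (fun i => φ (v i)) f = 0 ↔ _
  rw [← comp_aeval_apply, ← h f, map_eq_zero_iff φ φ.injective]

theorem isDefinedOver_zeroLocus (I : Ideal (MvPolynomial σ K)) :
    IsDefinedOver K (zeroLocus Ω I) := by
  refine le_antisymm ?_ (zeroLocus_vanishingIdeal_le _)
  exact zeroLocus_anti_mono (le_vanishingIdeal_zeroLocus I)

/-- A Noether normalization over K in s variables stays one over Ω: integrality is inherited, and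
injectivity holds because every point of Ω^s lifts to a point of V. So s is both the transcendence
degree over K and the Krull dimension over Ω. -/
theorem trdeg_coordinateRing [IsAlgClosed Ω] [Finite σ] {V : Set (σ → Ω)}
    (hirr : IsZariskiIrreducible V) (hdef : IsDefinedOver K V) {n : ℕ} (hdim : zariskiDim V = n) :
    Algebra.trdeg K (MvPolynomial σ K ⧸ vanishingIdeal K V) = n := by
  have hP := vanishingIdeal_isPrime K hirr
  have hPΩ := vanishingIdeal_isPrime Ω hirr
  obtain ⟨s, g, hginj, hgint⟩ :=
    exists_integral_inj_algHom_of_fg K (MvPolynomial σ K ⧸ vanishingIdeal K V)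
  have hex : ∀ i, ∃ t : MvPolynomial σ K, Ideal.Quotient.mk (vanishingIdeal K V) t = g (X i) :=
    fun i => Ideal.Quotient.mk_surjective _
  choose t ht using hex
  have hgt : ∀ p, g p = Ideal.Quotient.mk (vanishingIdeal K V) (aeval t p) := by
    intro p
    have : g = (Ideal.Quotient.mkₐ K (vanishingIdeal K V)).comp (aeval t) := by
      ext i; simp [ht]
    rw [this]; rfl
  have htr : Algebra.trdeg K (MvPolynomial σ K ⧸ vanishingIdeal K V) = s := by
    have hindep : AlgebraicIndependent K (fun i => g (X i)) := by
      have : aeval (fun i => g (X i)) = g := by ext; simp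
      rw [AlgebraicIndependent, this]; exact hginj
    let _ := g.toRingHom.toAlgebra
    have : IsScalarTower K (MvPolynomial (Fin s) K) (MvPolynomial σ K ⧸ vanishingIdeal K V) :=
      IsScalarTower.of_algebraMap_eq' g.comp_algebraMap.symm
    have hint : Algebra.IsIntegral (MvPolynomial (Fin s) K)
      (MvPolynomial σ K ⧸ vanishingIdeal K V) := ⟨hgint⟩
    have hf1 : FaithfulSMul (MvPolynomial (Fin s) K) (MvPolynomial σ K ⧸ vanishingIdeal K V) :=
      (faithfulSMul_iff_algebraMap_injective _ _).2 hginj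
    have := lift_trdeg_add_eq K (MvPolynomial (Fin s) K) (MvPolynomial σ K ⧸ vanishingIdeal K V)
    rw [trdeg_eq_zero (R := MvPolynomial (Fin s) K)] at this
    simpa using this.symm
  rw [htr]
  have hlift : ∀ a : Fin s → Ω, ∃ v ∈ V, ∀ i, aeval v (t i) = a i := by
    intro a
    let _ := g.toRingHom.toAlgebra
    have hint : Algebra.IsIntegral (MvPolynomial (Fin s) K)
      (MvPolynomial σ K ⧸ vanishingIdeal K V) := ⟨hgint⟩
    obtain ⟨φ, hφ⟩ := exists_ringHom_comp_algebraMap_eq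
      (R := MvPolynomial (Fin s) K) (S := MvPolynomial σ K ⧸ vanishingIdeal K V) hginj
      (aeval a : MvPolynomial (Fin s) K →ₐ[K] Ω).toRingHom
    have hφ' : ∀ p, φ (g p) = aeval a p := fun p => congrArg (fun h : _ →+* Ω => h p) hφ
    have hval : ∀ f : MvPolynomial σ K, aeval (fun i => φ (Ideal.Quotient.mk _ (X i))) f
        = φ (Ideal.Quotient.mk _ f) := by
      intro f
      induction f using MvPolynomial.induction_on with
      | C c =>
        have h1 := hφ' (C c)
        rw [hgt] at h1
        simpa [algebraMap_eq] using h1.symm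
      | add p q hp hq => simp [hp, hq]
      | mul_X p i hp => simp [hp]
    refine ⟨fun i => φ (Ideal.Quotient.mk _ (X i)), ?_, ?_⟩
    · refine hdef.le fun f hf => ?_
      rw [hval, Ideal.Quotient.eq_zero_iff_mem.2 hf, map_zero]
    · intro i
      rw [hval, ht, hφ', aeval_X]
  let G : MvPolynomial (Fin s) Ω →ₐ[Ω] MvPolynomial σ Ω ⧸ vanishingIdeal Ω V :=
    (Ideal.Quotient.mkₐ Ω (vanishingIdeal Ω V)).comp (aeval fun i => map (algebraMap K Ω) (t i))
  have hGinj : Function.Injective G := by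
    rw [injective_iff_map_eq_zero]
    intro F hF
    apply MvPolynomial.funext
    intro a
    obtain ⟨v, hv, hva⟩ := hlift a
    have h1 := Ideal.Quotient.eq_zero_iff_mem.1 hF v hv
    change aeval v ((aeval fun i => map (algebraMap K Ω) (t i)) F) = 0 at h1
    rw [comp_aeval_apply] at h1
    simp only [aeval_map_algebraMap, hva] at h1
    simpa [aeval_eq_eval] using h1
  let ψ : (MvPolynomial σ K ⧸ vanishingIdeal K V) →+* (MvPolynomial σ Ω ⧸ vanishingIdeal Ω V) :=
    Ideal.quotientMap _ (map (algebraMap K Ω)) (fun f hf => (map_mem_vanishingIdeal_iff Ω).2 hf)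
  have hψmk : ∀ f, ψ (Ideal.Quotient.mk _ f) = Ideal.Quotient.mk _ (map (algebraMap K Ω) f) :=
    fun f => rfl
  have hψ : ψ.comp (g : _ →+* _) = (G : MvPolynomial (Fin s) Ω →+* _).comp (map (algebraMap K Ω)) := by
    ext x
    · simp only [RingHom.coe_comp, Function.comp_apply]
      rw [RingHom.coe_coe, hgt, hψmk]
      simp [G]
      rfl
    · simp only [RingHom.coe_comp, Function.comp_apply]
      rw [RingHom.coe_coe, hgt, hψmk]
      simp [G]
  let _ := G.toRingHom.toAlgebra
  have hint : Algebra.IsIntegral (MvPolynomial (Fin s) Ω)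
      (MvPolynomial σ Ω ⧸ vanishingIdeal Ω V) := by
    refine ⟨fun c => ?_⟩
    obtain ⟨f, rfl⟩ := Ideal.Quotient.mk_surjective c
    induction f using MvPolynomial.induction_on with
    | C c =>
      have : Ideal.Quotient.mk (vanishingIdeal Ω V) (C c)
          = algebraMap (MvPolynomial (Fin s) Ω) _ (C c) := by
        change _ = G (C c)
        simp [G]
        rfl
      rw [this]
      exact isIntegral_algebraMap
    | add p q hp hq => rw [map_add]; exact hp.add hq
    | mul_X p i hp =>
      rw [map_mul]
      refine hp.mul ?_
      obtain ⟨p, hp, hpx⟩ := hgint (Ideal.Quotient.mk _ (X i))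
      refine ⟨p.map (map (algebraMap K Ω)), hp.map _, ?_⟩
      rw [Polynomial.eval₂_map]
      change Polynomial.eval₂ ((G : MvPolynomial (Fin s) Ω →+* MvPolynomial σ Ω ⧸ vanishingIdeal Ω V).comp (map (algebraMap K Ω))) _ _ = 0
      have hX : Ideal.Quotient.mk (vanishingIdeal Ω V) (X i) = ψ (Ideal.Quotient.mk _ (X i)) := by
        rw [hψmk, map_X]
      rw [← hψ, hX, ← Polynomial.hom_eval₂]
      have : Polynomial.eval₂ (g : MvPolynomial (Fin s) K →+* MvPolynomial σ K ⧸ vanishingIdeal K V)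
          (Ideal.Quotient.mk (vanishingIdeal K V) (X i)) p = 0 := hpx
      rw [this, map_zero]
  have hdim' := zariskiDim_eq_ringKrullDim (V := V) (hdef.extend Ω)
  have := ringKrullDim_eq_of_isIntegral (R := MvPolynomial (Fin s) Ω)
    (S := MvPolynomial σ Ω ⧸ vanishingIdeal Ω V) hGinj
  rw [← hdim', hdim, MvPolynomial.ringKrullDim_of_isNoetherianRing] at this
  simp at this
  exact_mod_cast this.symm

end Generic
end

noncomputable section

section GenericPoints

open scoped IntermediateField.algebraAdjoinAdjoin

variable {K Ω σ : Type*} [Field K] [Field Ω] [Algebra K Ω]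

theorem trdeg_intermediateField_adjoin {E : Type*} [Field E] [Algebra K E] (S : Set E) :
    Algebra.trdeg K (IntermediateField.adjoin K S) = Algebra.trdeg K (Algebra.adjoin K S) := by
  have h := trdeg_add_eq K (Algebra.adjoin K S) (A := IntermediateField.adjoin K S)
  rw [trdeg_eq_zero (R := Algebra.adjoin K S), add_zero] at h
  exact h.symm

theorem IsGenericOver.trdeg_eq [IsAlgClosed Ω] [Finite σ] {V : Set (σ → Ω)}
    (hirr : IsZariskiIrreducible V) (hdef : IsDefinedOver K V) {n : ℕ} (hdim : zariskiDim V = n)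
    {E : Type*} [Field E] [Algebra K E] {v : σ → E} (hv : IsGenericOver K V v) :
    Algebra.trdeg K (IntermediateField.adjoin K (Set.range v)) = n := by
  rw [trdeg_intermediateField_adjoin, Algebra.adjoin_range_eq_range_aeval]
  have hker : vanishingIdeal K V = RingHom.ker (aeval v : MvPolynomial σ K →ₐ[K] E) := by
    ext f
    rw [RingHom.mem_ker, hv f]
  have e : (MvPolynomial σ K ⧸ vanishingIdeal K V) ≃ₐ[K] (aeval v : MvPolynomial σ K →ₐ[K] E).range :=
    (Ideal.quotientEquivAlgOfEq K hker).trans (Ideal.quotientKerEquivRange _)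
  have := e.lift_trdeg_eq
  rw [trdeg_coordinateRing hirr hdef hdim] at this
  simpa using this.symm

/-- The coordinate ring of V over K maps onto K[v]; both are domains of the same finite
transcendence degree, so the map is injective. -/
theorem isGenericOver_of_trdeg_eq [IsAlgClosed Ω] [Finite σ] {V : Set (σ → Ω)}
    (hirr : IsZariskiIrreducible V) (hdef : IsDefinedOver K V) {n : ℕ} (hdim : zariskiDim V = n)
    {v : σ → Ω} (hv : v ∈ V)
    (htr : Algebra.trdeg K (IntermediateField.adjoin K (Set.range v)) = n) :
    IsGenericOver K V v := by
  have hP := vanishingIdeal_isPrime K hirr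
  have hle : ∀ f ∈ vanishingIdeal K V, (aeval v : MvPolynomial σ K →ₐ[K] Ω).rangeRestrict f = 0 := by
    intro f hf
    ext
    exact hf v hv
  let φ : (MvPolynomial σ K ⧸ vanishingIdeal K V) →ₐ[K] (aeval v : MvPolynomial σ K →ₐ[K] Ω).range :=
    Ideal.Quotient.liftₐ _ _ hle
  have hφ : Function.Surjective φ := by
    rintro ⟨_, f, rfl⟩
    exact ⟨Ideal.Quotient.mk _ f, rfl⟩
  rw [trdeg_intermediateField_adjoin, Algebra.adjoin_range_eq_range_aeval] at htr
  obtain ⟨s, hs⟩ := exists_isTranscendenceBasis K (aeval v : MvPolynomial σ K →ₐ[K] Ω).range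
  have hcard := hs.cardinalMk_eq_trdeg
  rw [htr] at hcard
  have : Finite s := by
    rw [← Cardinal.lt_aleph0_iff_finite, hcard]; exact Cardinal.natCast_lt_aleph0
  choose a ha using fun b : s => hφ b
  have hinj : Function.Injective φ := by
    refine injective_of_algebraicIndependent_comp φ a ?_ ?_
    · have : φ ∘ a = Subtype.val := funext ha
      rw [this]
      exact hs.1
    · rw [trdeg_coordinateRing hirr hdef hdim]
      have : Nat.card s = n := by
        simp [Nat.card, hcard]
      rw [this]
  intro f
  constructor
  · intro hf
    rw [← Ideal.Quotient.eq_zero_iff_mem]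
    apply hinj
    rw [map_zero]
    ext
    exact hf
  · exact fun hf => hf v hv

/-- A polynomial killing v_i gives a function vanishing on V. It splits over Ω, where the ideal of V
is still prime, so some factor X_i - c vanishes on V. -/
theorem IsGenericOver.transcendental [IsAlgClosed Ω] {V : Set (σ → Ω)}
    (hirr : IsZariskiIrreducible V) {E : Type*} [Field E] [Algebra K E] {v : σ → E}
    (hv : IsGenericOver K V v) {i : σ} (hi : ∀ c, ¬ V ⊆ {v | v i = c}) : Transcendental K (v i) := by
  rintro ⟨p, hp0, hp⟩
  have hP := vanishingIdeal_isPrime Ω hirr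
  have h1 : Polynomial.aeval (X i) p ∈ vanishingIdeal K V := by
    rw [← hv, ← Polynomial.aeval_algHom_apply, aeval_X, hp]
  have h2 : Polynomial.aeval (X i : MvPolynomial σ Ω) (p.map (algebraMap K Ω))
      ∈ vanishingIdeal Ω V := by
    intro w hw
    have := h1 w hw
    rw [← Polynomial.aeval_algHom_apply, aeval_X] at this ⊢
    rwa [Polynomial.aeval_map_algebraMap]
  rw [(IsAlgClosed.splits (p.map (algebraMap K Ω))).eq_prod_roots, map_mul, map_multiset_prod,
    Multiset.map_map] at h2
  rcases hP.mem_or_mem h2 with h | h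
  · rw [Polynomial.aeval_C] at h
    obtain ⟨w, hw⟩ := (vanishingIdeal_isPrime_iff_irreducible.1 hP).1
    have := h w hw
    simp [hp0] at this
  · rw [hP.multiset_prod_mem_iff_exists_mem] at h
    obtain ⟨q, hq, hqV⟩ := h
    obtain ⟨c, -, rfl⟩ := Multiset.mem_map.1 hq
    apply hi c
    intro w hw
    have := hqV w hw
    simpa [sub_eq_zero] using this

theorem IsGenericOver.apply_ne {V : Set (σ → Ω)} {E : Type*} [Field E] [Algebra K E] {v : σ → E}
    (hv : IsGenericOver K V v) {i j : σ} (hij : ¬ V ⊆ {v | v i = v j}) : v i ≠ v j := by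
  intro h
  apply hij
  intro w hw
  have : X i - X j ∈ vanishingIdeal K V := by
    rw [← hv]; simp [h]
  simpa [sub_eq_zero] using this w hw

/-- A relation between these coordinates would hold on the projection, hence by density on the whole
affine space. -/
theorem IsGenericOver.algebraicIndependent_of_dense {V : Set (σ → Ω)} {ι : Type*} {κ : ι → σ}
    (hd : IsZariskiDense ((fun v i => v (κ i)) '' V)) {E : Type*} [Field E] [Algebra K E]
    {v : σ → E} (hv : IsGenericOver K V v) [Infinite Ω] :
    AlgebraicIndependent K (fun i => v (κ i)) := by
  rw [algebraicIndependent_iff]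
  intro p hp
  let _ := zariskiTopology Ω ι
  have hd' : Dense ((fun (v : σ → Ω) i => v (κ i)) '' V) := hd
  have h1 : rename κ p ∈ vanishingIdeal K V := by
    rw [← hv, aeval_rename]; exact hp
  have hclosed : IsClosed (zeroLocus Ω (Ideal.span {map (algebraMap K Ω) p})) :=
    isClosed_zariskiTopology_iff.2 ⟨_, rfl⟩
  have hsub : ((fun (v : σ → Ω) i => v (κ i)) '' V) ⊆
      zeroLocus Ω (Ideal.span {map (algebraMap K Ω) p}) := by
    rintro _ ⟨w, hw, rfl⟩
    have := h1 w hw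
    rw [aeval_rename] at this
    rw [zeroLocus_span]
    rintro _ rfl
    rwa [aeval_map_algebraMap]
  have huniv := hclosed.closure_subset_iff.2 hsub
  rw [hd'.closure_eq] at huniv
  have h0 : map (algebraMap K Ω) p = 0 := by
    apply MvPolynomial.funext
    intro a
    have := huniv (Set.mem_univ a) _ (Ideal.subset_span rfl)
    simpa [aeval_eq_eval] using this
  exact (map_eq_zero_iff _ (map_injective _ (algebraMap K Ω).injective)).1 h0

/-- The function field over `K` of an irreducible set `V` provides a generic point. -/
theorem exists_isGenericOver.{u, v, w} (K : Type u) {Ω : Type v} {σ : Type w} [Field K] [Field Ω] [Algebra K Ω] [Finite σ]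
    {V : Set (σ → Ω)} (hirr : IsZariskiIrreducible V) :
    ∃ (E : Type (max u w)) (_ : Field E) (_ : Algebra K E) (v : σ → E), IsGenericOver K V v ∧
      IntermediateField.adjoin K (Set.range v) = ⊤ ∧ Algebra.EssFiniteType K E := by
  have hP := vanishingIdeal_isPrime K hirr
  refine ⟨FractionRing (MvPolynomial σ K ⧸ vanishingIdeal K V), inferInstance, inferInstance,
    fun i => algebraMap (MvPolynomial σ K ⧸ vanishingIdeal K V) _ (Ideal.Quotient.mk _ (X i)),
    ?_, ?_, ?_⟩
  · intro f
    have h2 : aeval (fun i => algebraMap (MvPolynomial σ K ⧸ vanishingIdeal K V)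
        (FractionRing (MvPolynomial σ K ⧸ vanishingIdeal K V)) (Ideal.Quotient.mk _ (X i)))
        = (IsScalarTower.toAlgHom K (MvPolynomial σ K ⧸ vanishingIdeal K V)
          (FractionRing (MvPolynomial σ K ⧸ vanishingIdeal K V))).comp
            (Ideal.Quotient.mkₐ K (vanishingIdeal K V)) := by
      ext i; simp
    rw [h2]
    simp [Ideal.Quotient.eq_zero_iff_mem]
  · rw [eq_top_iff]
    intro x _
    obtain ⟨a, b, hb, rfl⟩ := IsFractionRing.div_surjective (A := MvPolynomial σ K ⧸ vanishingIdeal K V) x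
    have key : ∀ a : MvPolynomial σ K ⧸ vanishingIdeal K V, algebraMap _ (FractionRing _) a ∈
        IntermediateField.adjoin K (Set.range fun i => algebraMap (MvPolynomial σ K ⧸ vanishingIdeal K V)
          (FractionRing (MvPolynomial σ K ⧸ vanishingIdeal K V)) (Ideal.Quotient.mk _ (X i))) := by
      intro a
      obtain ⟨f, rfl⟩ := Ideal.Quotient.mk_surjective a
      induction f using MvPolynomial.induction_on with
      | C c =>
        have : algebraMap _ (FractionRing (MvPolynomial σ K ⧸ vanishingIdeal K V))
            (Ideal.Quotient.mk (vanishingIdeal K V) (C c)) = algebraMap K _ c := by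
          rw [IsScalarTower.algebraMap_apply K (MvPolynomial σ K ⧸ vanishingIdeal K V)]
          rfl
        rw [this]
        exact IntermediateField.algebraMap_mem _ c
      | add p q hp hq => rw [map_add, map_add]; exact add_mem hp hq
      | mul_X p i hp =>
        rw [map_mul, map_mul]
        exact mul_mem hp (IntermediateField.subset_adjoin _ _ ⟨i, rfl⟩)
    exact div_mem (key a) (key b)
  · have : Algebra.EssFiniteType (MvPolynomial σ K ⧸ vanishingIdeal K V)
      (FractionRing (MvPolynomial σ K ⧸ vanishingIdeal K V)) :=
      .of_isLocalization _ (nonZeroDivisors (MvPolynomial σ K ⧸ vanishingIdeal K V))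
    exact .comp K (MvPolynomial σ K ⧸ vanishingIdeal K V) _

end GenericPoints
end

noncomputable section

/-! ### Derivations as a test for algebraicity -/

section Constants

variable {K E N : Type*} [Field K] [Field E] [Algebra K E] [AddCommGroup N] [Module E N]
  [Module K N]

/-- The field of constants of a derivation of a field. -/
def Derivation.constantField (D : Derivation K E N) : IntermediateField K E where
  carrier := {a | D a = 0}
  mul_mem' {a b} ha hb := by
    simp only [Set.mem_ofPred_eq] at *
    rw [D.leibniz, ha, hb, smul_zero, smul_zero, add_zero]
  add_mem' {a b} ha hb := by
    simp only [Set.mem_ofPred_eq] at *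
    rw [map_add, ha, hb, add_zero]
  algebraMap_mem' a := D.map_algebraMap a
  inv_mem' a ha := by
    simp only [Set.mem_ofPred_eq] at *
    rw [D.leibniz_inv, ha, smul_zero]

theorem Derivation.mem_constantField_of_isAlgebraic [CharZero K] (D : Derivation K E N) {a : E}
    (ha : IsAlgebraic D.constantField a) : a ∈ D.constantField := by
  let D' : Derivation D.constantField E N := Derivation.mk'
    { toFun := D
      map_add' := map_add D
      map_smul' := by
        intro c b
        have hc : D (c : E) = 0 := c.2
        change D ((c : E) * b) = (c : E) • D b
        rw [D.leibniz, hc, smul_zero, add_zero] }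
    (fun b c => D.leibniz b c)
  have : CharZero D.constantField := charZero_of_injective_algebraMap (algebraMap K _).injective
  have h1 := D'.map_aeval (minpoly D.constantField a) a
  rw [minpoly.aeval, map_zero] at h1
  have hsep : (minpoly D.constantField a).Separable := (minpoly.irreducible ha.isIntegral).separable
  have h2 := hsep.aeval_derivative_ne_zero (minpoly.aeval D.constantField a)
  exact (smul_eq_zero.1 h1.symm).resolve_left h2

/-- Modulo the span of the dw_j the universal derivation kills K(w), hence also E, which is
algebraic over it. So du is a combination of the dw_j, and one family of coefficients serves all D.
-/
theorem exists_derivation_apply_eq_sum [IsScalarTower K E N] [CharZero K] {ι : Type*} [Fintype ι] (w : ι → E)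
    [Algebra.IsAlgebraic (IntermediateField.adjoin K (Set.range w)) E] (u : E) :
    ∃ A : ι → E, ∀ D : Derivation K E N, D u = ∑ j, A j • D (w j) := by
  let P := Submodule.span E (Set.range fun j => KaehlerDifferential.D K E (w j))
  let D₀ : Derivation K E ((Ω[E⁄K]) ⧸ P) := P.mkQ.compDer (KaehlerDifferential.D K E)
  have hD₀ : ∀ a, D₀ a = Submodule.Quotient.mk (KaehlerDifferential.D K E a) := fun a => rfl
  have hle : IntermediateField.adjoin K (Set.range w) ≤ D₀.constantField := by
    rw [IntermediateField.adjoin_le_iff]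
    rintro _ ⟨j, rfl⟩
    change D₀ (w j) = 0
    rw [hD₀, Submodule.Quotient.mk_eq_zero]
    exact Submodule.subset_span ⟨j, rfl⟩
  have hu : u ∈ D₀.constantField := by
    apply D₀.mem_constantField_of_isAlgebraic
    have h1 := Algebra.IsAlgebraic.isAlgebraic (R := IntermediateField.adjoin K (Set.range w)) u
    obtain ⟨p, hp, hpu⟩ := h1
    refine ⟨p.map (IntermediateField.inclusion hle).toRingHom,
      (Polynomial.map_ne_zero_iff (RingHom.injective _)).2 hp, ?_⟩
    rw [Polynomial.aeval_def, Polynomial.eval₂_map]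
    exact hpu
  have hu' : KaehlerDifferential.D K E u ∈ P := by
    rw [← Submodule.Quotient.mk_eq_zero]; exact hu
  obtain ⟨A, hA⟩ := (Submodule.mem_span_range_iff_exists_fun E).1 hu'
  refine ⟨A, fun D => ?_⟩
  have := congrArg D.liftKaehlerDifferential hA
  simpa using this.symm

/-- Composing d with linear functionals on the Kähler differentials gives derivations of E; if all
vanish, the module is zero and the extension is unramified. -/
theorem isAlgebraic_of_forall_derivation_eq_zero {M E : Type*} [Field M] [Field E] [CharZero M]
    [Algebra M E] [Algebra.EssFiniteType M E] (h : ∀ (D : Derivation M E E) (a : E), D a = 0) :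
    Algebra.IsAlgebraic M E := by
  have hsub : Subsingleton (Ω[E⁄M]) := by
    rw [← Submodule.subsingleton_iff E]
    apply subsingleton_of_bot_eq_top
    rw [eq_comm, eq_bot_iff, ← KaehlerDifferential.span_range_derivation, Submodule.span_le]
    rintro _ ⟨a, rfl⟩
    rw [SetLike.mem_coe, Submodule.mem_bot, ← Module.forall_dual_apply_eq_zero_iff E]
    intro f
    exact h (f.compDer (KaehlerDifferential.D M E)) a
  have : Algebra.FormallyUnramified M E := ⟨hsub⟩
  have := (Algebra.FormallyUnramified.iff_isSeparable M E).1 this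
  infer_instance

end Constants

section PolynomialLifts

open Polynomial

theorem Polynomial.coeff_mem_of_mul_monic {E : Type*} [Field E] (Z : Subfield E) {P Q : E[X]}
    (hP : P.Monic) (hPZ : ∀ i, P.coeff i ∈ Z) (hPQ : ∀ i, (P * Q).coeff i ∈ Z) (i : ℕ) :
    Q.coeff i ∈ Z := by
  have lift : ∀ R : E[X], (∀ i, R.coeff i ∈ Z) → ∃ R' : Z[X], R'.map Z.subtype = R := by
    intro R hR
    have : R ∈ Polynomial.lifts Z.subtype := by
      rw [Polynomial.lifts_iff_coeff_lifts]
      intro i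
      exact ⟨⟨_, hR i⟩, rfl⟩
    exact (Polynomial.mem_lifts _).1 this
  obtain ⟨P', hP'⟩ := lift P hPZ
  obtain ⟨R', hR'⟩ := lift _ hPQ
  have hm : P'.Monic := by
    rw [← hP'] at hP
    exact Polynomial.monic_of_injective Subtype.val_injective hP
  have : (R' /ₘ P').map Z.subtype = Q := by
    rw [Polynomial.map_divByMonic _ hm, hP', hR', Polynomial.mul_divByMonic_cancel_left _ hP]
  rw [← this, Polynomial.coeff_map]
  exact ((R' /ₘ P').coeff i).2

end PolynomialLifts
end

noncomputable section

/-! ### The linear system for the differentials -/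

section TransversalMatrix

variable {n : ℕ}

/-- The matrix of the linear system in the differentials `dw_j` that is obtained from
`dy_i = s_i dx_i` and `du_i = ∑ A_ij dw_j`, where `(w_i, u_i) = (y_i, x_i)` if `ε i`
and `(w_i, u_i) = (x_i, y_i)` otherwise. -/
def transversalMatrix {R : Type*} [CommRing R] (ε : Fin n → Bool) (A : Matrix (Fin n) (Fin n) R)
    (s : Fin n → R) : Matrix (Fin n) (Fin n) R :=
  fun i j => if ε i then (1 : Matrix (Fin n) (Fin n) R) i j - s i * A i j
    else A i j - s i * (1 : Matrix (Fin n) (Fin n) R) i j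

theorem transversalMatrix_map {R S : Type*} [CommRing R] [CommRing S] (f : R →+* S)
    (ε : Fin n → Bool) (A : Matrix (Fin n) (Fin n) R) (s : Fin n → R) :
    f.mapMatrix (transversalMatrix ε A s) = transversalMatrix ε (f.mapMatrix A) (f ∘ s) := by
  ext i j
  simp only [transversalMatrix, RingHom.mapMatrix_apply, Matrix.map_apply, Function.comp_apply,
    Matrix.one_apply]
  split_ifs <;> simp

theorem exists_det_transversalMatrix_ne_zero {E : Type*} [Field E] [Infinite E] (ε : Fin n → Bool)
    (A : Matrix (Fin n) (Fin n) E) : ∃ s, (transversalMatrix ε A s).det ≠ 0 := by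
  have hp : Polynomial.X * A.charpoly ≠ 0 :=
    mul_ne_zero Polynomial.X_ne_zero A.charpoly_monic.ne_zero
  obtain ⟨c, hc⟩ : ∃ c, (Polynomial.X * A.charpoly).eval c ≠ 0 := by
    by_contra! h
    exact hp (Polynomial.funext fun c => by simpa using h c)
  rw [Polynomial.eval_mul, Polynomial.eval_X, Matrix.eval_charpoly] at hc
  have hc0 := left_ne_zero_of_mul hc
  have hdet := right_ne_zero_of_mul hc
  -- With these slopes each row is a nonzero multiple of the same row of c·1 - A, and c is neither 0
  -- nor an eigenvalue.
  refine ⟨fun i => if ε i then c⁻¹ else c, ?_⟩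
  have : transversalMatrix ε A (fun i => if ε i then c⁻¹ else c)
      = Matrix.diagonal (fun i => if ε i then c⁻¹ else -1) * (Matrix.scalar (Fin n) c - A) := by
    ext i j
    rw [Matrix.diagonal_mul]
    simp only [transversalMatrix, Matrix.sub_apply, Matrix.scalar_apply, Matrix.diagonal_apply,
      Matrix.one_apply]
    split_ifs <;> field_simp <;> ring
  rw [this, Matrix.det_mul, Matrix.det_diagonal]
  refine mul_ne_zero (Finset.prod_ne_zero_iff.2 fun i _ => ?_) hdet
  split_ifs
  · exact inv_ne_zero hc0
  · exact neg_ne_zero.2 one_ne_zero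

theorem det_transversalMatrix_generic_ne_zero {E : Type*} [Field E] [Infinite E] {m : ℕ}
    (hnm : n ≤ m) {x : Fin n → E} (hx : Function.Injective x) (ε : Fin n → Bool)
    (A : Matrix (Fin n) (Fin n) E) (a b : Fin n → E) (hb : ∀ i, b i ≠ 0) :
    (transversalMatrix ε ((C : E →+* MvPolynomial (Fin m) E).mapMatrix A)
      (fun i => C (a i) + C (b i) * ∑ j : Fin m, X j * C (x i ^ (j : ℕ)))).det ≠ 0 := by
  obtain ⟨s, hs⟩ := exists_det_transversalMatrix_ne_zero ε A
  -- Specializing the variables to the coefficients of this interpolant turns the generic slopes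
  -- into s; it has at most m coefficients because n ≤ m.
  let R := Lagrange.interpolate Finset.univ x (fun i => (s i - a i) / b i)
  have hR : R.degree < m := (Lagrange.degree_interpolate_lt _ hx.injOn).trans_le (by simpa using hnm)
  have hRx : ∀ i, ∑ j : Fin m, R.coeff j * x i ^ (j : ℕ) = (s i - a i) / b i := by
    intro i
    have := Lagrange.eval_interpolate_at_node (fun i => (s i - a i) / b i) hx.injOn (Finset.mem_univ i)
    rw [← this, Fin.sum_univ_eq_sum_range (fun j => R.coeff j * x i ^ j), eq_comm]
    by_cases h0 : R = 0
    · change R.eval _ = _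
      simp [h0]
    · exact Polynomial.eval_eq_sum_range' ((Polynomial.natDegree_lt_iff_degree_lt h0).2 hR) _
  intro h0
  apply hs
  have := congrArg (MvPolynomial.eval fun j : Fin m => R.coeff j) h0
  rw [RingHom.map_det, transversalMatrix_map, map_zero] at this
  rw [← this]
  congr 2
  · ext i j; simp
  · funext i
    simp [hRx]
    field_simp [hb i]
    ring

end TransversalMatrix
end

noncomputable section

/-! ### Solutions for independent coefficients -/

section GenericInterpolation

/-- If `dy_i = s_i dx_i` for a derivation trivial on `K` and `s_i` is generic enough, then the
derivation is trivial on the field generated by the transversal basis `w`. -/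
theorem derivation_eq_zero_of_det_ne_zero {K E L : Type*} [Field K] [CharZero K] [Field E]
    [Algebra K E] [Field L] [Algebra K L] [Algebra E L] [IsScalarTower K E L] {n : ℕ}
    (ε : Fin n → Bool) (x y : Fin n → E)
    [Algebra.IsAlgebraic
      (IntermediateField.adjoin K (Set.range fun i => if ε i then y i else x i)) E]
    (A : Matrix (Fin n) (Fin n) E)
    (hA : ∀ i (D : Derivation K E L), D (if ε i then x i else y i)
      = ∑ j, A i j • D (if ε j then y j else x j))
    (D : Derivation K E L) (s : Fin n → L) (hs : ∀ i, D (y i) = s i * D (x i))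
    (hdet : (transversalMatrix ε ((algebraMap E L).mapMatrix A) s).det ≠ 0) (u : E) : D u = 0 := by
  have hv : (transversalMatrix ε ((algebraMap E L).mapMatrix A) s).mulVec
      (fun j => D (if ε j then y j else x j)) = 0 := by
    funext i
    have h1 := hA i D
    have h2 : ∑ j, A i j • D (if ε j then y j else x j)
        = ∑ j, algebraMap E L (A i j) * D (if ε j then y j else x j) :=
      Finset.sum_congr rfl fun j _ => Algebra.smul_def _ _
    rw [h2] at h1
    have h3 : ∑ j, (1 : Matrix (Fin n) (Fin n) L) i j * D (if ε j then y j else x j)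
        = D (if ε i then y i else x i) := by
      simp [Matrix.one_apply]
    by_cases hi : ε i
    · simp only [Matrix.mulVec, dotProduct, transversalMatrix, hi, if_true, Pi.zero_apply,
        sub_mul, Finset.sum_sub_distrib, mul_assoc, ← Finset.mul_sum, RingHom.mapMatrix_apply,
        Matrix.map_apply]
      rw [h3, ← h1]
      simp [hi, hs]
    · simp only [Matrix.mulVec, dotProduct, transversalMatrix, hi, if_false, Pi.zero_apply,
        sub_mul, Finset.sum_sub_distrib, mul_assoc, ← Finset.mul_sum, RingHom.mapMatrix_apply,
        Matrix.map_apply, Bool.false_eq_true]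
      rw [h3, ← h1]
      simp [hi, hs]
  have hw := Matrix.eq_zero_of_mulVec_eq_zero hdet hv
  obtain ⟨B, hB⟩ := exists_derivation_apply_eq_sum (K := K) (N := L)
    (fun i => if ε i then y i else x i) u
  rw [hB D]
  refine Finset.sum_eq_zero fun j _ => ?_
  have := congrFun hw j
  simp only [Pi.zero_apply] at this
  rw [this, smul_zero]

open Polynomial in
/-- The generic polynomial of degree `< n + m` with prescribed values at `n` nodes. -/
theorem exists_generic_interpolation.{u, v} {K : Type u} {E : Type v} [Field K] [CharZero K]
    [Field E] [Algebra K E] [Algebra.EssFiniteType K E] {n m : ℕ} (hnm : n ≤ m)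
    (x y : Fin n → E) (ε : Fin n → Bool) (hx : Function.Injective x)
    (htr : Algebra.trdeg K E = n)
    (hw : AlgebraicIndependent K (fun i => if ε i then y i else x i)) (g₀ q : K[X])
    (hq : ∀ i, aeval (x i) q ≠ 0) :
    ∃ (L : Type v) (_ : Field L) (_ : Algebra K L) (ι : E →ₐ[K] L) (h : L[X]),
      h.degree < (n + m : ℕ) ∧ AlgebraicIndependent K (fun j : Fin (n + m) => h.coeff j) ∧
      Algebra.IsAlgebraic (Algebra.adjoin K (Set.range fun j : Fin (n + m) => h.coeff j)) L ∧
      ∀ i, ι (y i) = aeval (ι (x i)) g₀ + aeval (ι (x i)) q * h.eval (ι (x i)) := by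
  have : CharZero E := charZero_of_injective_algebraMap (algebraMap K E).injective
  let L := FractionRing (MvPolynomial (Fin m) E)
  let T : Fin m → L := fun j => algebraMap (MvPolynomial (Fin m) E) L (X j)
  -- The equation forces h(x_i) = η i. Multiples of the nodal polynomial W do not change these
  -- values, so R₁ is free.
  let η : Fin n → E := fun i => (y i - aeval (x i) g₀) / aeval (x i) q
  let R₀ : E[X] := Lagrange.interpolate Finset.univ x η
  let W : E[X] := Lagrange.nodal Finset.univ x
  let R₁ : L[X] := ∑ j : Fin m, Polynomial.C (T j) * Polynomial.X ^ (j : ℕ)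
  let h : L[X] := R₀.map (algebraMap E L) + W.map (algebraMap E L) * R₁
  have hR₁deg : R₁.degree < m := Polynomial.degree_sum_fin_lt _
  have hR₁coeff : ∀ j : Fin m, R₁.coeff j = T j := by
    intro j
    simp only [R₁, Polynomial.finsetSum_coeff, Polynomial.coeff_C_mul_X_pow, Fin.val_inj]
    simp
  have hW : W.Monic := Lagrange.nodal_monic
  have hWdeg : (W.map (algebraMap E L)).natDegree = n := by
    rw [Polynomial.natDegree_map, Lagrange.natDegree_nodal]; simp
  have hhdeg : h.degree < (n + m : ℕ) := by
    refine (Polynomial.degree_add_le _ _).trans_lt (max_lt ?_ ?_)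
    · rw [Polynomial.degree_map]
      refine (Lagrange.degree_interpolate_lt _ hx.injOn).trans_le ?_
      rw [Finset.card_univ, Fintype.card_fin]
      exact_mod_cast Nat.le_add_right n m
    · rw [Polynomial.degree_mul, Polynomial.degree_eq_natDegree (hW.map _).ne_zero, hWdeg,
        Nat.cast_add]
      exact WithBot.add_lt_add_left (by simp) hR₁deg
  let c : Fin (n + m) → L := fun j => h.coeff j
  let M := IntermediateField.adjoin K (Set.range c)
  have hηx : ∀ i, h.eval (algebraMap E L (x i)) = algebraMap E L (η i) := by
    intro i
    simp only [h, Polynomial.eval_add, Polynomial.eval_mul, Polynomial.eval_map_algebraMap,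
      Polynomial.aeval_algebraMap_apply, Polynomial.coe_aeval_eq_eval]
    rw [Lagrange.eval_interpolate_at_node _ hx.injOn (Finset.mem_univ i),
      Lagrange.eval_nodal_at_node (Finset.mem_univ i)]
    simp
  have hyx : ∀ i, algebraMap E L (y i) = aeval (algebraMap E L (x i)) g₀
      + aeval (algebraMap E L (x i)) q * h.eval (algebraMap E L (x i)) := by
    intro i
    rw [hηx, Polynomial.aeval_algebraMap_apply, Polynomial.aeval_algebraMap_apply, ← map_mul,
      ← map_add]
    congr 1
    simp only [η]
    field_simp [hq i]
    ring
  have hess : Algebra.EssFiniteType K L := by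
    have h1 : Algebra.EssFiniteType (MvPolynomial (Fin m) E) L :=
      .of_isLocalization _ (nonZeroDivisors (MvPolynomial (Fin m) E))
    have h2 : Algebra.EssFiniteType E L := .comp E (MvPolynomial (Fin m) E) L
    exact .comp K E L
  have hessM : Algebra.EssFiniteType M L := .of_comp K M L
  have hcharM : CharZero M := charZero_of_injective_algebraMap (algebraMap K M).injective
  have halgE : Algebra.IsAlgebraic
      (IntermediateField.adjoin K (Set.range fun i => if ε i then y i else x i)) E :=
    (hw.isTranscendenceBasis_of_lift_trdeg_le_of_finite (by simp [htr])).isAlgebraic_field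
  have hAex : ∀ i, ∃ A : Fin n → E, ∀ D : Derivation K E L, D (if ε i then x i else y i)
      = ∑ j, A j • D (if ε j then y j else x j) := fun i =>
    exists_derivation_apply_eq_sum (K := K) (N := L) (fun i => if ε i then y i else x i) _
  choose A hA using hAex
  -- the slopes at the nodes
  let a : Fin n → E := fun i => aeval (x i) (derivative g₀) + aeval (x i) (derivative q) * η i
    + aeval (x i) q * (derivative R₀).eval (x i)
  let b : Fin n → E := fun i => aeval (x i) q * (derivative W).eval (x i)
  let s : Fin n → MvPolynomial (Fin m) E := fun i =>
    MvPolynomial.C (a i) + MvPolynomial.C (b i) *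
      ∑ j : Fin m, MvPolynomial.X j * MvPolynomial.C (x i ^ (j : ℕ))
  have hb : ∀ i, b i ≠ 0 := by
    intro i
    refine mul_ne_zero (hq i) ?_
    rw [Lagrange.eval_nodal_derivative_eval_node_eq (Finset.mem_univ i), Lagrange.eval_nodal,
      Finset.prod_ne_zero_iff]
    intro j hj
    exact sub_ne_zero.2 (hx.ne (Finset.ne_of_mem_erase hj).symm)
  have hdet : (transversalMatrix ε ((algebraMap E L).mapMatrix (Matrix.of A))
      (fun i => algebraMap _ L (s i))).det ≠ 0 := by
    have h1 := det_transversalMatrix_generic_ne_zero hnm hx ε (Matrix.of A) a b hb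
    have h2 := (map_ne_zero_iff (algebraMap (MvPolynomial (Fin m) E) L)
      (IsFractionRing.injective _ _)).2 h1
    rw [RingHom.map_det, transversalMatrix_map] at h2
    convert! h2 using 3
  have hsum : ∀ i, algebraMap _ L (s i) = aeval (algebraMap E L (x i)) (derivative g₀)
      + (aeval (algebraMap E L (x i)) (derivative q) * h.eval (algebraMap E L (x i))
        + aeval (algebraMap E L (x i)) q * (derivative h).eval (algebraMap E L (x i))) := by
    intro i
    have hR₁x : R₁.eval (algebraMap E L (x i)) = algebraMap (MvPolynomial (Fin m) E) L
        (∑ j : Fin m, MvPolynomial.X j * MvPolynomial.C (x i ^ (j : ℕ))) := by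
      simp only [R₁, T, Polynomial.eval_finsetSum, Polynomial.eval_mul, Polynomial.eval_C,
        Polynomial.eval_pow, Polynomial.eval_X, map_sum, map_mul, map_pow]
      rfl
    have hW0 : (W.map (algebraMap E L)).eval (algebraMap E L (x i)) = 0 := by
      rw [Polynomial.eval_map_algebraMap, Polynomial.aeval_algebraMap_apply,
        Polynomial.coe_aeval_eq_eval, Lagrange.eval_nodal_at_node (Finset.mem_univ i), map_zero]
    have hC : ∀ e : E, algebraMap (MvPolynomial (Fin m) E) L (MvPolynomial.C e)
        = algebraMap E L e := fun e => rfl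
    have hh' : (derivative h).eval (algebraMap E L (x i))
        = algebraMap E L ((derivative R₀).eval (x i)) + algebraMap E L ((derivative W).eval (x i))
          * R₁.eval (algebraMap E L (x i)) := by
      simp only [h, derivative_add, derivative_mul, Polynomial.eval_add, Polynomial.eval_mul, hW0,
        zero_mul, add_zero, Polynomial.derivative_map]
      simp only [Polynomial.eval_map_algebraMap, Polynomial.aeval_algebraMap_apply,
        Polynomial.coe_aeval_eq_eval]
    rw [hh', hηx, hR₁x]
    simp only [s, map_add, map_mul, hC, a, b, Polynomial.aeval_algebraMap_apply]
    ring
  have halgM : Algebra.IsAlgebraic M L := by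
    apply isAlgebraic_of_forall_derivation_eq_zero
    intro D
    have hDh : ∀ j, D (h.coeff j) = 0 := by
      intro j
      by_cases hj : j < n + m
      · have : h.coeff j ∈ M := IntermediateField.subset_adjoin _ _ ⟨⟨j, hj⟩, rfl⟩
        exact D.map_algebraMap ⟨_, this⟩
      · rw [Polynomial.coeff_eq_zero_of_degree_lt, map_zero]
        exact hhdeg.trans_le (by exact_mod_cast not_lt.1 hj)
    have hDE : ∀ u : E, D (algebraMap E L u) = 0 := by
      refine derivation_eq_zero_of_det_ne_zero ε x y (Matrix.of A) hA
        ((D.restrictScalars K).compAlgebraMap E) (fun i => algebraMap _ L (s i)) ?_ hdet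
      intro i
      change D (algebraMap E L (y i)) = _ * D (algebraMap E L (x i))
      obtain ⟨h', hh'⟩ : ∃ h' : M[X], h'.map (algebraMap M L) = h := by
        have : h ∈ Polynomial.lifts (algebraMap M L) := by
          rw [Polynomial.lifts_iff_coeff_lifts]
          intro j
          by_cases hj : j < n + m
          · exact ⟨⟨_, IntermediateField.subset_adjoin _ _ ⟨⟨j, hj⟩, rfl⟩⟩, rfl⟩
          · rw [Polynomial.coeff_eq_zero_of_degree_lt]
            · exact ⟨0, map_zero _⟩
            · exact hhdeg.trans_le (by exact_mod_cast not_lt.1 hj)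
        exact (Polynomial.mem_lifts _).1 this
      have hG : algebraMap E L (y i) = aeval (algebraMap E L (x i))
          (g₀.map (algebraMap K M) + q.map (algebraMap K M) * h') := by
        rw [hyx, ← hh']
        simp [Polynomial.eval_map_algebraMap]
      rw [hG, D.map_aeval, hsum, ← hh', smul_eq_mul]
      congr 1
      simp [Polynomial.derivative_map, Polynomial.eval_map_algebraMap]
    let D' : Derivation K L L := D.restrictScalars K
    have hE : ∀ u : E, algebraMap E L u ∈ D'.constantField := hDE
    have hT : ∀ j, T j ∈ D'.constantField := by
      intro j
      -- D kills the coefficients of W and of W·R₁ = h - R₀; division by the monic W passes this on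
      -- to R₁.
      rw [← hR₁coeff j]
      refine Polynomial.coeff_mem_of_mul_monic D'.constantField.toSubfield
        (hW.map (algebraMap E L)) ?_ ?_ j
      · intro i; rw [Polynomial.coeff_map]; exact hE _
      · intro i
        have h1 : (W.map (algebraMap E L) * R₁).coeff i = h.coeff i - algebraMap E L (R₀.coeff i) := by
          simp [h]
        rw [h1]
        exact sub_mem (show h.coeff i ∈ D'.constantField from hDh i) (hE _)
    have hpoly : ∀ p : MvPolynomial (Fin m) E, algebraMap _ L p ∈ D'.constantField := by
      intro p
      induction p using MvPolynomial.induction_on with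
      | C e => exact hE e
      | add p q hp hq => rw [map_add]; exact add_mem hp hq
      | mul_X p i hp => rw [map_mul]; exact mul_mem hp (hT i)
    intro z
    obtain ⟨p, r, -, rfl⟩ := IsFractionRing.div_surjective (A := MvPolynomial (Fin m) E) z
    exact div_mem (hpoly p) (hpoly r)
  have halg : Algebra.IsAlgebraic (Algebra.adjoin K (Set.range c)) L := by
    open scoped IntermediateField.algebraAdjoinAdjoin in
    exact Algebra.IsAlgebraic.trans (Algebra.adjoin K (Set.range c)) M L
  have htrL : Algebra.trdeg K L = (n + m : ℕ) := by
    have h1 := lift_trdeg_add_eq E (MvPolynomial (Fin m) E) L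
    have h2 : Algebra.IsAlgebraic (MvPolynomial (Fin m) E) L :=
      IsLocalization.isAlgebraic _ (nonZeroDivisors (MvPolynomial (Fin m) E))
    rw [trdeg_eq_zero (R := MvPolynomial (Fin m) E)] at h1
    have h3 := trdeg_add_eq K E (A := L)
    rw [htr] at h3
    have h4 : Algebra.trdeg E L = m := by simpa using h1.symm
    rw [← h3, h4, Nat.cast_add]
  refine ⟨L, inferInstance, inferInstance, IsScalarTower.toAlgHom K E L, h, hhdeg, ?_, halg, hyx⟩
  -- L is algebraic over n + m elements and has transcendence degree n + m, so they are independent.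
  exact (Algebra.IsAlgebraic.isTranscendenceBasis_of_lift_le_trdeg_of_finite K c
    (by simp [htrL])).1

end GenericInterpolation
end

noncomputable section

section GenericSolution

theorem AlgebraicIndependent.exists_algHom_extend {K L₁ L ι : Type*} [Field K] [Field L₁] [Field L]
    [Algebra K L₁] [Algebra K L] [IsAlgClosed L] {c₁ : ι → L₁} {c : ι → L}
    (h₁ : AlgebraicIndependent K c₁) (h : AlgebraicIndependent K c)
    [Algebra.IsAlgebraic (Algebra.adjoin K (Set.range c₁)) L₁] :
    ∃ φ : L₁ →ₐ[K] L, ∀ j, φ (c₁ j) = c j := by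
  let θ : Algebra.adjoin K (Set.range c₁) →ₐ[K] L :=
    (aeval c).comp (h₁.aevalEquiv.symm : Algebra.adjoin K (Set.range c₁) →ₐ[K] MvPolynomial ι K)
  have hθ : Function.Injective θ := by
    have h' : Function.Injective (aeval c : MvPolynomial ι K →ₐ[K] L) := h
    exact h'.comp h₁.aevalEquiv.symm.injective
  let _ : Algebra (Algebra.adjoin K (Set.range c₁)) L := θ.toRingHom.toAlgebra
  have : IsScalarTower K (Algebra.adjoin K (Set.range c₁)) L :=
    IsScalarTower.of_algebraMap_eq' θ.comp_algebraMap.symm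
  have : Module.IsTorsionFree (Algebra.adjoin K (Set.range c₁)) L :=
    Module.isTorsionFree_iff_algebraMap_injective.2 hθ
  have : Module.IsTorsionFree (Algebra.adjoin K (Set.range c₁)) L₁ :=
    Module.isTorsionFree_iff_algebraMap_injective.2 Subtype.val_injective
  let φ : L₁ →ₐ[Algebra.adjoin K (Set.range c₁)] L := IsAlgClosed.lift
  refine ⟨φ.restrictScalars K, fun j => ?_⟩
  have h2 := φ.commutes ⟨c₁ j, Algebra.subset_adjoin ⟨j, rfl⟩⟩
  have h3 : h₁.aevalEquiv.symm ⟨c₁ j, Algebra.subset_adjoin ⟨j, rfl⟩⟩ = X j := by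
    rw [AlgEquiv.symm_apply_eq]
    ext
    simp
  have h4 : θ ⟨c₁ j, Algebra.subset_adjoin ⟨j, rfl⟩⟩ = c j := by
    change aeval c (h₁.aevalEquiv.symm _) = c j
    rw [h3, aeval_X]
  exact h2.trans h4

open Polynomial in
-- The generic interpolation polynomial has independent coefficients too. Matching them with those
-- of h extends to a K-embedding into L, which carries the generic point along.
theorem exists_isGenericOver_solution {K L : Type*} [Field K] [CharZero K] [Algebra K ℂ]
    [Field L] [IsAlgClosed L] [Algebra K L] {n m : ℕ} (hnm : n ≤ m) {V : Set (Fin n ⊕ Fin n → ℂ)}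
    (hxi : ConditionXi V) (hpsi : ConditionPsi V) (hdef : IsDefinedOver K V)
    (g₀ : K[X]) {q : K[X]} (hq : q ≠ 0) {h : L[X]} (hdeg : h.degree < (n + m : ℕ))
    (hind : AlgebraicIndependent K (fun j : Fin (n + m) => h.coeff j)) :
    ∃ v : Fin n ⊕ Fin n → L, IsGenericOver K V v ∧ ∀ i, v (Sum.inr i) =
      aeval (v (Sum.inl i)) g₀ + aeval (v (Sum.inl i)) q * h.eval (v (Sum.inl i)) := by
  obtain ⟨E, _, _, v₀, hv₀, htop, hess⟩ := exists_isGenericOver K hxi.irreducible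
  obtain ⟨ε, hε⟩ := hpsi
  have htr : Algebra.trdeg K E = n := by
    have h1 := hv₀.trdeg_eq hxi.irreducible hdef hxi.dim_eq
    rwa [htop, IntermediateField.topEquiv.trdeg_eq] at h1
  have hw : AlgebraicIndependent K
      (fun i => if ε i then v₀ (Sum.inr i) else v₀ (Sum.inl i)) := by
    have h1 : AlgebraicIndependent K
        (fun i => v₀ (if ε i then Sum.inr i else Sum.inl i)) := by
      refine hv₀.algebraicIndependent_of_dense ?_
      convert hε using 1
      unfold chosenProjection
      congr 1
      funext v i
      split_ifs <;> rfl
    convert! h1 using 2 with i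
    split_ifs <;> rfl
  have hx : Function.Injective fun i => v₀ (Sum.inl i) := by
    intro i j hij
    by_contra hne
    exact hv₀.apply_ne (hxi.not_subset_diag i j hne) hij
  have hqx : ∀ i, aeval (v₀ (Sum.inl i)) q ≠ 0 := fun i h0 =>
    hv₀.transcendental hxi.irreducible (hxi.not_subset_const i) ⟨q, hq, h0⟩
  obtain ⟨L₁, _, _, ι, h₁, hdeg₁, hind₁, halg₁, hsol⟩ := exists_generic_interpolation hnm
    (fun i => v₀ (Sum.inl i)) (fun i => v₀ (Sum.inr i)) ε hx htr hw g₀ q hqx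
  obtain ⟨φ, hφ⟩ := hind₁.exists_algHom_extend hind
  have hmap : h₁.map (φ : L₁ →+* L) = h := by
    ext j
    rw [Polynomial.coeff_map]
    by_cases hj : j < n + m
    · exact hφ ⟨j, hj⟩
    · have hj' : ((n + m : ℕ) : WithBot ℕ) ≤ j := by exact_mod_cast not_lt.1 hj
      rw [Polynomial.coeff_eq_zero_of_degree_lt (hdeg₁.trans_le hj'),
        Polynomial.coeff_eq_zero_of_degree_lt (hdeg.trans_le hj'), map_zero]
  refine ⟨(φ.comp ι) ∘ v₀, hv₀.map_algHom _, fun i => ?_⟩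
  have h1 := congrArg φ (hsol i)
  rw [map_add, map_mul, ← Polynomial.aeval_algHom_apply, ← Polynomial.aeval_algHom_apply] at h1
  simp only [Function.comp_apply, AlgHom.comp_apply]
  rw [h1, ← hmap, Polynomial.eval_map]
  congr 2
  exact (Polynomial.eval₂_at_apply (φ : L₁ →+* L) (ι (v₀ (Sum.inl i)))).symm

end GenericSolution
end

noncomputable section

/-! ### A place centred at t = 0 -/

section Place

open Polynomial

/-- Divide P by the highest power of the parameter dividing all its coefficients. -/
theorem Polynomial.exists_map_eval_zero_ne_zero {k R : Type*} [Field k] [CommRing R] [IsDomain R]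
    (ψ : k[X] →+* R) {b : R} (ht : ψ Polynomial.X ≠ 0) {P : k[X][X]} (hP : P ≠ 0)
    (hPb : P.eval₂ ψ b = 0) :
    ∃ P' : k[X][X], P'.eval₂ ψ b = 0 ∧ P'.map (evalRingHom (0 : k)) ≠ 0 := by
  have hCX : ¬ IsUnit (Polynomial.C (Polynomial.X : k[X])) := by
    rw [Polynomial.isUnit_C]; exact Polynomial.not_isUnit_X
  obtain ⟨e, P', hP', rfl⟩ := WfDvdMonoid.max_power_factor' hP hCX
  refine ⟨P', ?_, fun h0 => hP' ?_⟩
  · rw [Polynomial.eval₂_mul, Polynomial.eval₂_pow, Polynomial.eval₂_C] at hPb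
    exact (mul_eq_zero.1 hPb).resolve_left (pow_ne_zero _ ht)
  · rw [Polynomial.C_dvd_iff_dvd_coeff]
    intro i
    have := congrArg (fun p => p.coeff i) h0
    rw [Polynomial.X_dvd_iff, coeff_zero_eq_eval_zero]
    simpa using this

/-- A place of an algebraically closed field `L` with values in the algebraically closed
subfield `k`, with a transcendental element `t` in the valuation ideal. -/
theorem exists_place_of_isAlgClosed.{u} (k : Type u) [Field k] [IsAlgClosed k] :
    ∃ (L : Type u) (_ : Field L) (_ : IsAlgClosed L) (_ : Algebra k L) (O : Subalgebra k L)
      (π : O →ₐ[k] k) (t : O), Transcendental k (t : L) ∧ π t = 0 ∧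
      (∀ a : L, a ∉ O → ∃ b : O, (b : L) = a⁻¹ ∧ π b = 0) ∧
      ∀ a : O, π a ≠ 0 → (a : L)⁻¹ ∈ O := by
  let L := AlgebraicClosure (FractionRing k[X])
  let ψ : k[X] →+* L := algebraMap k[X] L
  have hψ : Function.Injective ψ := by
    have h : ψ = (algebraMap (FractionRing k[X]) L).comp (algebraMap k[X] (FractionRing k[X])) :=
      IsScalarTower.algebraMap_eq _ _ _
    rw [h]
    exact (algebraMap (FractionRing k[X]) L).injective.comp
      (IsFractionRing.injective k[X] (FractionRing k[X]))
  have hkψ : ∀ c : k, algebraMap k L c = ψ (Polynomial.C c) := fun c => by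
    rw [IsScalarTower.algebraMap_apply k k[X] L]; rfl
  let A : Subring L := ψ.range
  let tA : A := ⟨ψ Polynomial.X, Polynomial.X, rfl⟩
  have hI : Ideal.span {tA} ≠ ⊤ := by
    rw [Ne, Ideal.span_singleton_eq_top]
    intro hu
    obtain ⟨⟨_, p, rfl⟩, hp⟩ := hu.exists_right_inv
    have h1 : ψ (Polynomial.X * p) = ψ 1 := by
      rw [map_mul, map_one]; exact congrArg Subtype.val hp
    exact Polynomial.not_isUnit_X (IsUnit.of_mul_eq_one p (hψ h1))
  -- Chevalley's extension theorem: a valuation ring of L containing k[t], with t a nonunit.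
  obtain ⟨B, hAB, hIB⟩ := Ideal.image_subset_nonunits_valuationSubring _ hI
  have htB : ψ Polynomial.X ∈ B.nonunits := hIB ⟨tA, Ideal.mem_span_singleton_self tA, rfl⟩
  have hψB : ∀ p, ψ p ∈ B := fun p => hAB ⟨p, rfl⟩
  let res := IsLocalRing.residue B
  let ψB : k[X] →+* B := ψ.codRestrict B.toSubring hψB
  have htres : res (ψB Polynomial.X) = 0 := by
    rw [IsLocalRing.residue_eq_zero_iff]
    exact ValuationSubring.coe_mem_nonunits_iff.1 htB
  let φ : k →+* IsLocalRing.ResidueField B := res.comp (ψB.comp Polynomial.C)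
  let _ : Algebra k (IsLocalRing.ResidueField B) := φ.toAlgebra
  have hresψ : ∀ p, res (ψB p) = φ (p.eval 0) := by
    intro p
    have h1 : res.comp ψB = φ.comp (evalRingHom 0) := by
      ext c
      · simp [φ]
      · simp [htres]
    exact congrArg (fun f : k[X] →+* IsLocalRing.ResidueField B => f p) h1
  have hint : Algebra.IsIntegral k (IsLocalRing.ResidueField B) := by
    rw [← Algebra.isAlgebraic_iff_isIntegral]
    refine ⟨fun z => ?_⟩
    obtain ⟨b, rfl⟩ := IsLocalRing.residue_surjective z
    have hb : IsAlgebraic k[X] (b : L) := by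
      have : Algebra.IsAlgebraic k[X] (FractionRing k[X]) :=
        IsLocalization.isAlgebraic _ (nonZeroDivisors k[X])
      have : Algebra.IsAlgebraic k[X] L := .trans k[X] (FractionRing k[X]) L
      exact Algebra.IsAlgebraic.isAlgebraic _
    obtain ⟨P, hP, hPb⟩ := hb
    obtain ⟨P', hP'b, hP'⟩ := exists_map_eval_zero_ne_zero ψ
      ((map_ne_zero_iff ψ hψ).2 Polynomial.X_ne_zero) hP hPb
    refine ⟨P'.map (evalRingHom 0), hP', ?_⟩
    have h1 : P'.eval₂ ψB b = 0 := by
      apply Subtype.val_injective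
      have h2 := Polynomial.hom_eval₂ P' ψB B.subtype b
      exact h2.trans hP'b
    have h3 := congrArg res h1
    rw [Polynomial.hom_eval₂, map_zero] at h3
    rw [Polynomial.aeval_def, Polynomial.eval₂_map, ← h3]
    congr 1
    ext p
    · exact (hresψ _).symm
    · exact (hresψ _).symm
  have hbij : Function.Bijective φ :=
    IsAlgClosed.algebraMap_bijective_of_isIntegral (k := k) (K := IsLocalRing.ResidueField B)
  let e := RingEquiv.ofBijective φ hbij
  let O : Subalgebra k L :=
    { B.toSubring with algebraMap_mem' := fun c => by rw [hkψ]; exact hψB _ }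
  let π₀ : B →+* k := (e.symm : _ →+* k).comp res
  have hπ₀ : ∀ b : B, π₀ b = 0 ↔ ¬ IsUnit b := by
    intro b
    change e.symm (res b) = 0 ↔ _
    rw [map_eq_zero_iff _ e.symm.injective]
    exact (IsLocalRing.residue_eq_zero_iff b).trans (IsLocalRing.mem_maximalIdeal b)
  let π : O →ₐ[k] k :=
    { toRingHom := π₀
      commutes' := by
        intro c
        change e.symm (res ⟨algebraMap k L c, _⟩) = c
        rw [RingEquiv.symm_apply_eq]
        change res _ = φ c
        simp only [φ, RingHom.comp_apply]
        exact congrArg res (Subtype.ext (hkψ c)) }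
  refine ⟨L, inferInstance, inferInstance, inferInstance, O, π, ⟨ψ Polynomial.X, hψB Polynomial.X⟩, ?_, ?_, ?_, ?_⟩
  · rw [transcendental_iff]
    intro p hp
    apply hψ
    have h1 : (algebraMap k[X] L : k[X] →+* L) = (Polynomial.aeval (ψ Polynomial.X) : k[X] →ₐ[k] L).toRingHom := by
      ext c
      · simpa [ψ] using (hkψ c).symm
      · simp [ψ]
    rw [map_zero]
    change (algebraMap k[X] L : k[X] →+* L) p = 0
    rw [h1]
    exact hp
  · change e.symm (res (ψB Polynomial.X)) = 0
    rw [htres, map_zero]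
  · intro a ha
    have ha' : a ∉ B := ha
    have h1 : a⁻¹ ∈ B := (B.mem_or_inv_mem a).resolve_left ha'
    refine ⟨⟨a⁻¹, h1⟩, rfl, (hπ₀ ⟨a⁻¹, h1⟩).2 ?_⟩
    intro hu
    obtain ⟨⟨c, hc⟩, hac⟩ := hu.exists_right_inv
    have h2 : a⁻¹ * c = 1 := congrArg Subtype.val hac
    have h3 : c = a := by
      have ha0 : a ≠ 0 := fun h0 => ha' (h0 ▸ B.zero_mem)
      exact ((inv_mul_eq_one₀ ha0).1 h2).symm
    exact ha' (h3 ▸ hc)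
  · intro a ha
    have hu : IsUnit (⟨a.1, a.2⟩ : B) := by
      by_contra hu
      exact ha ((hπ₀ ⟨a.1, a.2⟩).2 hu)
    obtain ⟨⟨c, hc⟩, hac⟩ := hu.exists_right_inv
    have h2 : (a : L) * c = 1 := congrArg Subtype.val hac
    rw [inv_eq_of_mul_eq_one_right h2]
    exact hc

end Place
end

noncomputable section

/-! ### Specializing the deformed solution -/

section Specialization

open Polynomial

theorem exists_algebraicIndependent_of_le_trdeg {K A : Type*} [Field K] [CommRing A] [IsDomain A]
    [Algebra K A] {n : ℕ} (h : n ≤ Algebra.trdeg K A) :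
    ∃ x : Fin n → A, AlgebraicIndependent K x := by
  have hinj : Function.Injective (algebraMap K A) := FaithfulSMul.algebraMap_injective K A
  obtain ⟨s, hs⟩ := exists_isTranscendenceBasis K A
  rw [← hs.cardinalMk_eq_trdeg] at h
  obtain ⟨f⟩ : Nonempty (Fin n ↪ s) := by
    rw [← Cardinal.lift_mk_le']
    simpa using h
  exact ⟨fun i => (f i : A), hs.1.comp f f.injective⟩

/-- As t is transcendental over k, a relation holds identically in t; at t = 1 it becomes a relation
between the δ_j. -/
theorem AlgebraicIndependent.add_mul_sub {K k L ι : Type*} [Field K] [Field k] [Field L]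
    [Algebra K k] [Algebra k L] [Algebra K L] [IsScalarTower K k L] {t : L}
    (ht : Transcendental k t) {δ : ι → k} (hδ : AlgebraicIndependent K δ) (a : ι → k) :
    AlgebraicIndependent K
      (fun j => algebraMap k L (a j) + t * algebraMap k L (δ j - a j)) := by
  rw [algebraicIndependent_iff] at hδ ⊢
  intro F hF
  let c : ι → k[X] := fun j => Polynomial.C (a j) + Polynomial.X * Polynomial.C (δ j - a j)
  have h1 : Polynomial.aeval t (MvPolynomial.aeval c F) = 0 := by
    rw [← hF]
    have := (MvPolynomial.comp_aeval_apply (f := c)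
      ((Polynomial.aeval t : k[X] →ₐ[k] L).restrictScalars K) F)
    refine this.trans ?_
    congr 2
    funext j
    simp [c]
  have h2 : MvPolynomial.aeval c F = 0 := transcendental_iff.1 ht _ h1
  apply hδ F
  have h3 := (MvPolynomial.comp_aeval_apply (f := c)
    ((Polynomial.aeval (1 : k) : k[X] →ₐ[k] k).restrictScalars K) F)
  rw [h2, map_zero] at h3
  rw [h3]
  congr 2
  funext j
  simp [c]

/-- The remainder is the Lagrange interpolant of the values H(u_i), so it is defined over E. -/
theorem coeff_modByMonic_prod_mem {K L : Type*} [Field K] [Field L] [Algebra K L]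
    (E : IntermediateField K L) {n : ℕ} {u : Fin n → L} (hu : Function.Injective u)
    (huE : ∀ i, u i ∈ E) {H : L[X]} (hH : ∀ i, H.eval (u i) ∈ E) (j : ℕ) :
    (H %ₘ ∏ i, (Polynomial.X - Polynomial.C (u i))).coeff j ∈ E := by
  set W : L[X] := ∏ i, (Polynomial.X - Polynomial.C (u i)) with hWdef
  have hW : W.Monic := Polynomial.monic_prod_of_monic _ _ fun i _ => monic_X_sub_C _
  have hWdeg : W.degree = n := by
    rw [hWdef, degree_prod]
    simp
  let uE : Fin n → E := fun i => ⟨u i, huE i⟩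
  have huEi : Set.InjOn uE (Finset.univ : Finset (Fin n)) := fun i _ j _ hij =>
    hu (congrArg Subtype.val hij)
  let P : E[X] := Lagrange.interpolate Finset.univ uE fun i => ⟨H.eval (u i), hH i⟩
  have hP : P.map (algebraMap E L) = H %ₘ W := by
    apply Polynomial.eq_of_degrees_lt_of_eval_index_eq (s := Finset.univ) (v := u) (hu.injOn)
    · rw [degree_map]
      exact Lagrange.degree_interpolate_lt _ huEi
    · have := degree_modByMonic_lt H hW
      rw [hWdeg] at this
      simpa using this
    · intro i _
      have hWi : W.eval (u i) = 0 := by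
        rw [hWdef, Polynomial.eval_prod]
        exact Finset.prod_eq_zero (Finset.mem_univ i) (by simp)
      have h1 : (H %ₘ W).eval (u i) = H.eval (u i) := by
        conv_rhs => rw [← modByMonic_add_div H W]
        rw [Polynomial.eval_add, Polynomial.eval_mul, hWi, zero_mul, add_zero]
      rw [h1]
      have h2 : (P.map (algebraMap E L)).eval (algebraMap E L (uE i))
          = algebraMap E L (P.eval (uE i)) := by
        rw [eval_map_apply]
      refine h2.trans ?_
      rw [Lagrange.eval_interpolate_at_node _ huEi (Finset.mem_univ i)]
      rfl
  rw [← hP, Polynomial.coeff_map]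
  exact (P.coeff j).2

/-- Division with remainder by W in the coordinate 1/(X - e), translated back to X. -/
theorem exists_eq_taylor_reflect_add_mul {k : Type*} [Field k] {n m : ℕ} (hm : 1 ≤ m) {h : k[X]}
    (hdeg : h.degree < (n + m : ℕ)) (e : k) {W : k[X]} (hW : W.Monic) (hWn : W.natDegree = n) :
    ∃ h₁ : k[X], h₁.degree < m ∧
      h = taylor (-e) (reflect (n + m - 1) (reflect (n + m - 1) (taylor e h) %ₘ W)) +
        taylor (-e) (reflect n W) * h₁ := by
  set H := reflect (n + m - 1) (taylor e h) with hH
  have hnat : ∀ {j : ℕ} {p : k[X]}, p.natDegree ≤ j - 1 → 1 ≤ j → p.degree < j := fun h1 h2 =>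
    lt_of_le_of_lt degree_le_natDegree (by exact_mod_cast by omega)
  have hhn : (taylor e h).natDegree ≤ n + m - 1 := by
    rw [natDegree_taylor]
    by_cases h0 : h = 0
    · simp [h0]
    · have := (natDegree_lt_iff_degree_lt h0).2 hdeg
      omega
  have hHn : H.natDegree ≤ n + m - 1 := by
    refine natDegree_reflect_le.trans (max_le le_rfl hhn)
  have hH₁ : (H /ₘ W).natDegree ≤ m - 1 := by
    rw [natDegree_divByMonic _ hW, hWn]
    omega
  refine ⟨taylor (-e) (reflect (m - 1) (H /ₘ W)), ?_, ?_⟩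
  · refine hnat ?_ hm
    rw [natDegree_taylor]
    exact natDegree_reflect_le.trans (max_le le_rfl hH₁)
  · rw [← taylor_mul, ← reflect_mul _ _ hWn.le hH₁, show n + (m - 1) = n + m - 1 by omega,
      ← map_add, ← reflect_add, modByMonic_add_div, hH, reflect_reflect, taylor_taylor]
    simp

variable {K : Type*} {L : Type} [Field K] [Field L] [Algebra K ℂ] [Algebra ℂ L] [Algebra K L]

theorem exists_eq_map_add_map_mul {E : IntermediateField K L} {O : Subalgebra ℂ L}
    {π : O →ₐ[ℂ] ℂ} (hinf : ∀ a : L, a ∉ O → ∃ b : O, (b : L) = a⁻¹ ∧ π b = 0)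
    (hinv : ∀ a : O, π a ≠ 0 → (a : L)⁻¹ ∈ O)
    {K' : IntermediateField K ℂ} (hK' : ∀ y, y ∈ K' ↔ ∃ a : O, (a : L) ∈ E ∧ π a = y) {n m : ℕ}
    (hm : 1 ≤ m) {x : Fin n → L} (hx : Function.Injective x) (hxE : ∀ i, x i ∈ E) {p : O[X]}
    (hp : p.degree < (n + m : ℕ)) (hpE : ∀ i, (p.map (algebraMap O L)).eval (x i) ∈ E) :
    ∃ (Q w : K'[X]) (h₁ : ℂ[X]), w ≠ 0 ∧ h₁.degree < m ∧
      p.map π.toRingHom = Q.map (algebraMap K' ℂ) + w.map (algebraMap K' ℂ) * h₁ := by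
  classical
  -- Some nodes may go to infinity. With e different from all finite residues, every u_i = 1/(x_i -
  -- e) lies in O, and division by ∏ (X - u_i) can be reduced. The default 0 below merely excludes
  -- one more value of e.
  obtain ⟨e, he⟩ : ∃ e : ℕ, ∀ (i : Fin n) (a : O), (a : L) = x i → π a ≠ e := by
    let c : Fin n → ℂ := fun i => if h : x i ∈ O then π ⟨x i, h⟩ else 0
    obtain ⟨_, ⟨e, rfl⟩, he⟩ := (Set.infinite_range_of_injective
      (Nat.cast_injective (R := ℂ))).exists_notMem_finite (Set.finite_range c)
    refine ⟨e, fun i a ha hae => he ⟨i, ?_⟩⟩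
    have h : x i ∈ O := ha ▸ a.2
    have h1 : (⟨x i, h⟩ : O) = a := Subtype.ext ha.symm
    simp only [c, dif_pos h, h1, hae]
  have heO : (e : L) ∈ O := natCast_mem O e
  have hxe : ∀ i, x i - e ≠ 0 := fun i h =>
    he i e (by rw [sub_eq_zero.1 h]; rfl) (map_natCast π e)
  have huO : ∀ i, (x i - e)⁻¹ ∈ O := by
    intro i
    by_cases hi : x i ∈ O
    · refine hinv (⟨x i, hi⟩ - (e : O)) ?_
      rw [map_sub, map_natCast, sub_ne_zero]
      exact he i _ rfl
    · obtain ⟨b, hb, -⟩ := hinf (x i - e) fun h => hi (by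
        have := add_mem h heO
        rwa [sub_add_cancel] at this)
      exact hb ▸ b.2
  let u : Fin n → O := fun i => ⟨(x i - e)⁻¹, huO i⟩
  have huE : ∀ i, (u i : L) ∈ E := fun i => inv_mem (sub_mem (hxE i) (natCast_mem E e))
  have hu : Function.Injective fun i => (u i : L) := fun i j hij =>
    hx (sub_left_injective (inv_injective hij))
  set N := n + m - 1 with hN
  let H : O[X] := reflect N (taylor (e : O) p)
  let W : O[X] := ∏ i, (Polynomial.X - Polynomial.C (u i))
  have hW : W.Monic := Polynomial.monic_prod_of_monic _ _ fun i _ => monic_X_sub_C _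
  have hWn : W.natDegree = n := by
    rw [natDegree_prod_of_monic _ _ fun i _ => monic_X_sub_C _]
    simp
  have hpN : p.natDegree ≤ N := by
    by_cases h0 : p = 0
    · simp [h0]
    · have := (natDegree_lt_iff_degree_lt h0).2 hp
      omega
  have hHmap : ∀ {R : Type} [CommRing R] (f : O →+* R),
      H.map f = reflect N (taylor (e : R) (p.map f)) := fun f => by
    simp only [H, ← reflect_map, map_taylor, map_natCast]
  have hHE : ∀ i, (H.map (algebraMap O L)).eval (u i : L) ∈ E := by
    intro i
    rw [hHmap]
    have h1 : (taylor (e : L) (p.map (algebraMap O L))).natDegree ≤ N := by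
      rw [natDegree_taylor]
      exact natDegree_map_le.trans hpN
    have : Invertible (x i - e) := invertibleOfNonzero (hxe i)
    have h2 := eval₂_reflect_mul_pow (RingHom.id L) (x i - e) N _ h1
    rw [← Polynomial.eval, ← Polynomial.eval, taylor_eval, sub_add_cancel, invOf_eq_inv] at h2
    -- So H(u_i) = p(x_i) / (x_i - e)^N.
    have h3 := eq_div_of_mul_eq (pow_ne_zero _ (hxe i)) h2
    change Polynomial.eval (x i - e)⁻¹ _ ∈ E
    rw [h3]
    exact div_mem (hpE i) (pow_mem (sub_mem (hxE i) (natCast_mem E e)) _)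
  have hQE : ∀ j, (((H %ₘ W).coeff j : O) : L) ∈ E := by
    intro j
    have h1 := coeff_modByMonic_prod_mem E hu huE hHE j
    have h2 : ∏ i, (Polynomial.X - Polynomial.C (u i : L)) = W.map (algebraMap O L) := by
      simp only [W, Polynomial.map_prod, Polynomial.map_sub, Polynomial.map_X, Polynomial.map_C]
      rfl
    rw [h2, ← map_modByMonic _ hW, Polynomial.coeff_map] at h1
    exact h1
  obtain ⟨Q', hQ'⟩ : ∃ Q' : K'[X], Q'.map (algebraMap K' ℂ) = (H %ₘ W).map π.toRingHom := by
    rw [← mem_lifts, lifts_iff_coeff_lifts]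
    intro j
    rw [Polynomial.coeff_map]
    exact ⟨⟨_, (hK' _).2 ⟨_, hQE j, rfl⟩⟩, rfl⟩
  let W' : K'[X] := ∏ i, (Polynomial.X - Polynomial.C ⟨π (u i), (hK' _).2 ⟨_, huE i, rfl⟩⟩)
  have hW'0 : W' ≠ 0 :=
    (Polynomial.monic_prod_of_monic _ _ fun i _ => monic_X_sub_C _).ne_zero
  have hW' : W'.map (algebraMap K' ℂ) = W.map π.toRingHom := by
    simp only [W, W', Polynomial.map_prod, Polynomial.map_sub, Polynomial.map_X, Polynomial.map_C]
    rfl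
  obtain ⟨h₁, hh₁, heq⟩ := exists_eq_taylor_reflect_add_mul (n := n) hm (h := p.map π.toRingHom)
    (degree_map_le.trans_lt hp) (e : ℂ) (hW.map π.toRingHom) (by rw [hW.natDegree_map, hWn])
  refine ⟨taylor (-(e : K')) (reflect N Q'), taylor (-(e : K')) (reflect n W'), h₁, ?_, hh₁, ?_⟩
  · rw [Ne, map_eq_zero_iff _ (taylor_injective _), reflect_eq_zero_iff]
    exact hW'0
  · rw [map_taylor, map_taylor, ← reflect_map, ← reflect_map, hQ', hW', map_modByMonic _ hW,
      hHmap, map_neg, map_natCast]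
    exact heq

variable [IsScalarTower K ℂ L]

/-- The residue field of the restriction of a place to an intermediate field. -/
theorem exists_residueField_eq (E : IntermediateField K L) {O : Subalgebra ℂ L} (π : O →ₐ[ℂ] ℂ)
    (hinv : ∀ a : O, π a ≠ 0 → (a : L)⁻¹ ∈ O) :
    ∃ K' : IntermediateField K ℂ, ∀ y, y ∈ K' ↔ ∃ a : O, (a : L) ∈ E ∧ π a = y := by
  let S : Subalgebra K O := E.toSubalgebra.comap (O.val.restrictScalars K)
  refine ⟨(S.map (π.restrictScalars K)).toIntermediateField ?_, fun y => Iff.rfl⟩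
  rintro _ ⟨a, ha, rfl⟩
  change (π a)⁻¹ ∈ _
  by_cases h0 : π a = 0
  · rw [h0, inv_zero]
    exact zero_mem _
  · refine ⟨⟨(a : L)⁻¹, hinv a h0⟩, inv_mem (S := IntermediateField K L) (x := (a : L)) ha, ?_⟩
    change π _ = _
    refine eq_inv_of_mul_eq_one_left ?_
    rw [← map_mul]
    have ha0 : (a : L) ≠ 0 := fun h => h0 (by rw [Subtype.ext (a2 := (0 : O)) h, map_zero])
    rw [show (⟨(a : L)⁻¹, hinv a h0⟩ : O) * a = 1 from Subtype.ext (inv_mul_cancel₀ ha0), map_one]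

/-- The place is injective on E ∩ O, its image having enough independent elements. Then E lies in O:
an element outside would have a nonzero inverse sent to 0. -/
theorem exists_algHom_of_le_trdeg_residueField {E : IntermediateField K L} {O : Subalgebra ℂ L}
    {π : O →ₐ[ℂ] ℂ} (hinf : ∀ a : L, a ∉ O → ∃ b : O, (b : L) = a⁻¹ ∧ π b = 0)
    {K' : IntermediateField K ℂ} (hK' : ∀ y, y ∈ K' ↔ ∃ a : O, (a : L) ∈ E ∧ π a = y) {n : ℕ}
    (hE : Algebra.trdeg K E = n) (hn : n ≤ Algebra.trdeg K K') :
    ∃ f : E →ₐ[K] ℂ, ∀ b : E, ∃ a : O, (a : L) = b ∧ f b = π a := by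
  let S : Subalgebra K O := E.toSubalgebra.comap (O.val.restrictScalars K)
  let φ : S →ₐ[K] ℂ := (π.restrictScalars K).comp S.val
  let ψ : S →ₐ[K] E := AlgHom.codRestrict ((O.val.restrictScalars K).comp S.val) E.toSubalgebra
    fun a => a.2
  have hψ : Function.Injective ψ := fun a b hab =>
    Subtype.ext (Subtype.ext (congrArg (fun c : E => (c : L)) hab))
  have htr : Algebra.trdeg K S ≤ n := by
    have := trdeg_le_of_injective ψ hψ
    rwa [hE] at this
  obtain ⟨y, hy⟩ := exists_algebraicIndependent_of_le_trdeg hn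
  choose b hbE hb using fun i => (hK' (y i)).1 (y i).2
  let c : Fin n → S := fun i => ⟨b i, hbE i⟩
  have hφ : Function.Injective φ := by
    refine injective_of_algebraicIndependent_comp φ c ?_ (by simpa using htr)
    have h1 : φ ∘ c = K'.val ∘ y := funext hb
    rw [h1]
    exact hy.map' K'.val.injective
  have hEO : ∀ a ∈ E, a ∈ O := by
    intro a ha
    by_contra haO
    obtain ⟨b, hb, hb0⟩ := hinf a haO
    have h1 : (⟨b, show (b : L) ∈ E from hb ▸ inv_mem ha⟩ : S) = 0 :=
      hφ (by rw [map_zero]; exact hb0)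
    have h2 : (b : L) = 0 := congrArg (fun s : S => ((s : O) : L)) h1
    rw [hb, inv_eq_zero] at h2
    exact haO (h2 ▸ zero_mem O)
  have hψs : Function.Surjective ψ := fun a => ⟨⟨⟨a, hEO a a.2⟩, a.2⟩, rfl⟩
  let ε : S ≃ₐ[K] E := AlgEquiv.ofBijective ψ ⟨hψ, hψs⟩
  refine ⟨φ.comp ε.symm.toAlgHom, fun b => ⟨ε.symm b, ?_, rfl⟩⟩
  exact congrArg (fun c : E => (c : L)) (ε.apply_symm_apply b)

theorem exists_place_with_generic_lift (hK : Cardinal.aleph0 ≤ Algebra.trdeg K ℂ) {N : ℕ}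
    {h : ℂ[X]} (hdeg : h.degree < N) {O : Subalgebra ℂ L} {π : O →ₐ[ℂ] ℂ} {t : O}
    (ht : Transcendental ℂ (t : L)) (hπt : π t = 0) :
    ∃ p : O[X], p.degree < N ∧ p.map π.toRingHom = h ∧
      AlgebraicIndependent K fun j : Fin N => (p.map (algebraMap O L)).coeff j := by
  obtain ⟨δ, hδ⟩ := exists_algebraicIndependent_of_le_trdeg (n := N)
    ((Cardinal.natCast_lt_aleph0 (n := N)).le.trans hK)
  let hδp : ℂ[X] := ∑ j : Fin N, Polynomial.monomial j (δ j)
  have hδc : ∀ j : Fin N, hδp.coeff j = δ j := by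
    intro j
    simp [hδp, Polynomial.finsetSum_coeff, Polynomial.coeff_monomial, Fin.val_inj]
  have hδdeg : hδp.degree < N := by
    rw [Polynomial.degree_lt_iff_coeff_zero]
    intro i hi
    simp only [hδp, Polynomial.finsetSum_coeff, Polynomial.coeff_monomial]
    exact Finset.sum_eq_zero fun j _ => if_neg (by omega)
  -- The line from h at t = 0 to a polynomial with K-independent coefficients at t = 1.
  refine ⟨h.map (algebraMap ℂ O) + Polynomial.C t * (hδp - h).map (algebraMap ℂ O), ?_, ?_, ?_⟩
  · rw [Polynomial.degree_lt_iff_coeff_zero] at hdeg hδdeg ⊢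
    intro i hi
    simp [hdeg i hi, hδdeg i hi]
  · have h1 : π.toRingHom.comp (algebraMap ℂ O) = RingHom.id ℂ := RingHom.ext fun c => π.commutes c
    rw [Polynomial.map_add, Polynomial.map_mul, Polynomial.map_C, Polynomial.map_map,
      Polynomial.map_map, h1, Polynomial.map_id]
    change h + Polynomial.C (π t) * _ = h
    rw [hπt, map_zero, zero_mul, add_zero]
  · convert hδ.add_mul_sub ht (fun j => h.coeff j) using 2 with j
    simp only [Polynomial.coeff_map, Polynomial.coeff_add, Polynomial.coeff_C_mul,
      Polynomial.coeff_sub, hδc]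
    rw [map_add, map_mul, ← IsScalarTower.algebraMap_apply, ← IsScalarTower.algebraMap_apply]
    rfl

end Specialization

open Polynomial in
/-- Either the system `y = g₀(x) + q(x) h(x)` has a generic solution on `V`, or `h` has a special
shape over a field of smaller transcendence degree. -/
theorem exists_isGenericOver_or_exists_reduction {K : Type*} [Field K] [CharZero K] [Algebra K ℂ]
    (hK : Cardinal.aleph0 ≤ Algebra.trdeg K ℂ) {n m : ℕ} (hnm : n ≤ m)
    {V : Set (Fin n ⊕ Fin n → ℂ)} (hxi : ConditionXi V) (hpsi : ConditionPsi V)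
    (hdef : IsDefinedOver K V) (g₀ : K[X]) {q : K[X]} (hq : q ≠ 0) {h : ℂ[X]}
    (hdeg : h.degree < (n + m : ℕ)) :
    (∃ v : Fin n ⊕ Fin n → ℂ, IsGenericOver K V v ∧
      ∀ i, v (Sum.inr i) = Polynomial.aeval (v (Sum.inl i)) g₀ +
        Polynomial.aeval (v (Sum.inl i)) q * h.eval (v (Sum.inl i))) ∨
    ∃ K' : IntermediateField K ℂ, Algebra.trdeg K K' < n ∧
      ∃ (Q w : K'[X]) (h₁ : ℂ[X]), w ≠ 0 ∧ h₁.degree < m ∧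
        h = Q.map (algebraMap K' ℂ) + w.map (algebraMap K' ℂ) * h₁ := by
  obtain ⟨L, hL, hLc, hCL, O, π, t, ht, hπt, hinf, hinv⟩ := exists_place_of_isAlgClosed ℂ
  let _ : Algebra K L := ((algebraMap ℂ L).comp (algebraMap K ℂ)).toAlgebra
  have : IsScalarTower K ℂ L := IsScalarTower.of_algebraMap_eq fun _ => rfl
  obtain ⟨p, hpdeg, hpπ, hpind⟩ := exists_place_with_generic_lift hK hdeg ht hπt
  obtain ⟨v, hv, hveq⟩ := exists_isGenericOver_solution hnm hxi hpsi hdef g₀ hq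
    (Polynomial.degree_map_le.trans_lt hpdeg) hpind
  let E : IntermediateField K L := IntermediateField.adjoin K (Set.range v)
  have hvE : ∀ i, v i ∈ E := fun i => IntermediateField.subset_adjoin _ _ ⟨i, rfl⟩
  have hE : Algebra.trdeg K E = n := hv.trdeg_eq hxi.irreducible hdef hxi.dim_eq
  obtain ⟨K', hK'⟩ := exists_residueField_eq E π hinv
  by_cases hn : (n : Cardinal) ≤ Algebra.trdeg K K'
  · left
    obtain ⟨f, hf⟩ := exists_algHom_of_le_trdeg_residueField hinf hK' hE hn
    let vE : Fin n ⊕ Fin n → E := fun i => ⟨v i, hvE i⟩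
    have hvE' : IsGenericOver K V vE := by
      intro F
      rw [← hv F]
      have h1 : E.val (aeval vE F) = aeval v F :=
        comp_aeval_apply (f := vE) E.val F
      rw [← h1]
      exact (map_eq_zero_iff E.val E.val.injective).symm
    refine ⟨f ∘ vE, hvE'.map_algHom f, fun i => ?_⟩
    obtain ⟨a, ha, hfa⟩ := hf (vE (Sum.inl i))
    obtain ⟨b, hb, hfb⟩ := hf (vE (Sum.inr i))
    have hKO : ∀ s : K[X], Polynomial.aeval (π a) s = π (Polynomial.aeval a s) := fun s =>
      (Polynomial.aeval_algHom_apply (π.restrictScalars K) a s)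
    have hKL : ∀ s : K[X], Polynomial.aeval (a : L) s = (Polynomial.aeval a s : O) := fun s =>
      (Polynomial.aeval_algHom_apply (O.val.restrictScalars K) a s)
    have hab : b = Polynomial.aeval a g₀ + Polynomial.aeval a q * p.eval a := by
      apply Subtype.ext
      have h1 := hveq i
      rw [← show (a : L) = v (Sum.inl i) from ha, ← show (b : L) = v (Sum.inr i) from hb, hKL,
        hKL] at h1
      rw [h1]
      have h2 : (p.map (algebraMap O L)).eval (a : L) = (p.eval a : O) :=
        Polynomial.eval_map_apply (algebraMap O L) a
      rw [h2]
      rfl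
    change f (vE (Sum.inr i)) = Polynomial.aeval (f (vE (Sum.inl i))) g₀ +
        Polynomial.aeval (f (vE (Sum.inl i))) q * h.eval (f (vE (Sum.inl i)))
    rw [hfa, hfb, hab, map_add, map_mul, hKO, hKO, ← hpπ]
    congr 2
    exact (Polynomial.eval_map_apply π.toRingHom a).symm
  · right
    rw [not_le] at hn
    -- Together with n ≤ m this gives 1 ≤ m, needed for the reflection degree n + m - 1.
    have hn0 : n ≠ 0 := by
      rintro rfl
      simp at hn
    obtain ⟨Q, w, h₁, hw, hh₁, heq⟩ := exists_eq_map_add_map_mul hinf hinv hK' (n := n) (m := m)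
      (by omega) (x := fun i => v (Sum.inl i))
      (fun i j hij => by
        by_contra hne
        exact hv.apply_ne (hxi.not_subset_diag i j hne) hij)
      (fun i => hvE _) hpdeg (fun i => by
        have hKE : ∀ s : K[X], Polynomial.aeval (v (Sum.inl i)) s ∈ E := fun s => by
          rw [show v (Sum.inl i) = E.val ⟨_, hvE (Sum.inl i)⟩ from rfl,
            Polynomial.aeval_algHom_apply]
          exact Subtype.property _
        have hq0 : Polynomial.aeval (v (Sum.inl i)) q ≠ 0 := fun h0 =>
          hq (transcendental_iff.1
            (hv.transcendental hxi.irreducible (hxi.not_subset_const i)) q h0)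
        have h1 := eq_div_of_mul_eq hq0
          ((mul_comm _ _).trans (sub_eq_of_eq_add' (hveq i)).symm)
        rw [h1]
        exact div_mem (sub_mem (hvE _) (hKE g₀)) (hKE q))
    exact ⟨K', hn, Q, w, h₁, hw, hh₁, by rw [← hpπ, heq]⟩
end

noncomputable section

/-! ### Induction on the number of relations -/

section Descent

theorem trdeg_adjoin_range_le {K E : Type} [Field K] [Field E] [Algebra K E] {m : ℕ}
    (a : Fin m → E) : Algebra.trdeg K (IntermediateField.adjoin K (Set.range a)) ≤ m := by
  rw [trdeg_intermediateField_adjoin, Algebra.adjoin_range_eq_range_aeval]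
  have h := trdeg_le_of_surjective (aeval a : MvPolynomial (Fin m) K →ₐ[K] E).rangeRestrict
    (AlgHom.rangeRestrict_surjective _)
  rw [MvPolynomial.trdeg_of_isDomain] at h
  simpa using h

open Polynomial in
-- The coefficients of h lie in the field generated over K' by those of h₁.
theorem trdeg_adjoin_coeff_le {K F : Type} [Field K] [Field F] [Algebra K F]
    {K' : IntermediateField K F} {Q w : K'[X]} {h h₁ : F[X]} {m : ℕ} (hdeg : h₁.degree < m)
    (heq : h = Q.map (algebraMap K' F) + w.map (algebraMap K' F) * h₁) (c : ℕ) :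
    Algebra.trdeg K (IntermediateField.adjoin K (Set.range fun j : Fin c => h.coeff j)) ≤
      Algebra.trdeg K K' + Algebra.trdeg K'
        (IntermediateField.adjoin K' (Set.range fun j : Fin m => h₁.coeff j)) := by
  set B := IntermediateField.adjoin K' (Set.range fun j : Fin m => h₁.coeff j) with hB
  have hcoeff : ∀ j, h₁.coeff j ∈ B := by
    intro j
    by_cases hj : j < m
    · exact IntermediateField.subset_adjoin _ _ ⟨⟨j, hj⟩, rfl⟩
    · rw [Polynomial.degree_lt_iff_coeff_zero] at hdeg
      rw [hdeg j (not_lt.1 hj)]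
      exact zero_mem _
  have hmem : IntermediateField.adjoin K (Set.range fun j : Fin c => h.coeff j) ≤
      B.restrictScalars K := by
    rw [IntermediateField.adjoin_le_iff]
    rintro _ ⟨j, rfl⟩
    change h.coeff j ∈ B
    rw [heq, Polynomial.coeff_add, Polynomial.coeff_mul, Polynomial.coeff_map]
    refine add_mem (B.algebraMap_mem _) (sum_mem fun i _ => mul_mem ?_ (hcoeff _))
    rw [Polynomial.coeff_map]
    exact B.algebraMap_mem _
  have : FaithfulSMul K' B :=
    (faithfulSMul_iff_algebraMap_injective K' B).2 (algebraMap K' B).injective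
  rw [trdeg_add_eq K K' (A := B)]
  exact trdeg_le_of_injective (IntermediateField.inclusion hmem)
    (IntermediateField.inclusion_injective hmem)

open Polynomial in
/-- The system `y = g₀(x) + q(x) h(x)` has a generic solution on `V` as soon as the degree bound
`c` for `h` is large compared to the number `r` of relations between the coefficients. -/
theorem exists_isGenericOver_of_le_trdeg_coeff {n : ℕ} {V : Set (Fin n ⊕ Fin n → ℂ)}
    (hxi : ConditionXi V) (hpsi : ConditionPsi V) (r : ℕ) :
    ∀ {K : Type} [Field K] [CharZero K] [Algebra K ℂ] (_ : Cardinal.aleph0 ≤ Algebra.trdeg K ℂ)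
      (_ : IsDefinedOver K V) (g₀ : K[X]) {q : K[X]} (_ : q ≠ 0) {c : ℕ} (_ : n * (r + 2) ≤ c)
      {h : ℂ[X]} (_ : h.degree < c) (_ : (c : Cardinal) ≤ Algebra.trdeg K
        (IntermediateField.adjoin K (Set.range fun j : Fin c => h.coeff j)) + r),
      ∃ v : Fin n ⊕ Fin n → ℂ, IsGenericOver K V v ∧
        ∀ i, v (Sum.inr i) = Polynomial.aeval (v (Sum.inl i)) g₀ +
          Polynomial.aeval (v (Sum.inl i)) q * h.eval (v (Sum.inl i)) := by
  induction r with
  | zero =>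
    intro K _ _ _ hK hdef g₀ q hq c hc h hdeg htr
    obtain ⟨m, rfl⟩ : ∃ m, c = n + m := ⟨c - n, by lia⟩
    refine (exists_isGenericOver_or_exists_reduction hK (by lia) hxi hpsi hdef g₀ hq
      hdeg).resolve_right ?_
    -- A reduction would bound the transcendence degree of n + m independent coefficients by
    -- something smaller than n + m.
    rintro ⟨K', hK', Q, w, h₁, hw, hh₁, heq⟩
    refine absurd htr (not_le.2 ?_)
    rw [Nat.cast_zero, add_zero, Nat.cast_add]
    refine (trdeg_adjoin_coeff_le hh₁ heq _).trans_lt ?_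
    refine (add_le_add_right (trdeg_adjoin_range_le _) _).trans_lt ?_
    obtain ⟨a, -, haK'⟩ := Cardinal.exists_nat_eq_of_le_nat hK'.le
    rw [haK'] at hK' ⊢
    exact_mod_cast Nat.add_lt_add_right (by exact_mod_cast hK') m
  | succ r ih =>
    intro K _ _ _ hK hdef g₀ q hq c hc h hdeg htr
    have hc' : n * (r + 3) = n + n * (r + 2) := by ring
    obtain ⟨m, rfl⟩ : ∃ m, c = n + m := ⟨c - n, by lia⟩
    have hm : n * (r + 2) ≤ m := by lia
    have hnm : n ≤ m := le_trans (Nat.le_mul_of_pos_right n (by lia)) hm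
    refine (exists_isGenericOver_or_exists_reduction hK hnm hxi hpsi hdef g₀ hq
      hdeg).elim id ?_
    rintro ⟨K', hK', Q, w, h₁, hw, hh₁, heq⟩
    obtain ⟨a, ha, haK'⟩ := Cardinal.exists_nat_eq_of_le_nat hK'.le
    obtain ⟨b, hb, hbB⟩ := Cardinal.exists_nat_eq_of_le_nat
      (trdeg_adjoin_range_le (K := K') fun j : Fin m => h₁.coeff j)
    have han : a < n := by
      rw [haK'] at hK'
      exact_mod_cast hK'
    have hle := htr.trans (add_le_add_left (trdeg_adjoin_coeff_le hh₁ heq _) _)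
    rw [haK', hbB] at hle
    -- As a < n, this gives m ≤ b + r: one relation fewer over K'.
    have hle' : n + m ≤ a + b + (r + 1) := by exact_mod_cast hle
    have hKK' : Cardinal.aleph0 ≤ Algebra.trdeg K' ℂ := by
      rw [← trdeg_add_eq K K' (A := ℂ), haK'] at hK
      by_contra hlt
      exact absurd hK (not_le.2 (Cardinal.add_lt_aleph0 Cardinal.natCast_lt_aleph0
        (not_le.1 hlt)))
    have : CharZero K' := charZero_of_injective_algebraMap (algebraMap K K').injective
    have hq' : q.map (algebraMap K K') ≠ 0 :=
      (Polynomial.map_ne_zero_iff (algebraMap K K').injective).2 hq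
    -- Substituting h = Q + w·h₁ gives a system of the same form over K', with g₀ + q·Q and q·w for
    -- g₀ and q.
    obtain ⟨v, hv, hveq⟩ := ih hKK' (hdef.extend K')
      (g₀.map (algebraMap K K') + q.map (algebraMap K K') * Q) (mul_ne_zero hq' hw) hm hh₁ (by
        rw [hbB]
        exact_mod_cast (by lia : m ≤ b + r))
    refine ⟨v, hv.restrict, fun i => ?_⟩
    rw [hveq i, heq]
    simp only [map_add, map_mul, Polynomial.aeval_map_algebraMap, Polynomial.eval_add,
      Polynomial.eval_mul, Polynomial.eval_map_algebraMap]
    ring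

end Descent
end

noncomputable section

/-! ### Application to the modified partial sums -/

section GenericPolynomial

theorem isDefinedOver_paramVariety {n m : ℕ}
    (Φ : Finset (MvPolynomial ((Fin n ⊕ Fin n) ⊕ Fin m) ℚ)) (z : Fin m → ℂ) :
    IsDefinedOver (paramField z) (paramVariety Φ z) := by
  let zF : Fin m → paramField z := fun i => ⟨z i, IntermediateField.subset_adjoin _ _ ⟨i, rfl⟩⟩
  let s : MvPolynomial ((Fin n ⊕ Fin n) ⊕ Fin m) ℚ →ₐ[ℚ]
    MvPolynomial (Fin n ⊕ Fin n) (paramField z) := aeval (Sum.elim X fun i => C (zF i))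
  have hs : ∀ (v : Fin n ⊕ Fin n → ℂ) p, aeval v (s p) = aeval (Sum.elim v z) p := by
    intro v p
    have h := comp_aeval_apply (f := Sum.elim X fun i => C (zF i))
      ((aeval v : MvPolynomial (Fin n ⊕ Fin n) (paramField z) →ₐ[paramField z] ℂ).restrictScalars ℚ)
      p
    refine h.trans ?_
    congr 2
    funext i
    cases i with
    | inl i => simp
    | inr i => simp [zF]
  have h : paramVariety Φ z = zeroLocus ℂ (Ideal.span (s '' Φ)) := by
    ext v
    rw [zeroLocus_span]
    simp [paramVariety, hs]
  rw [h]
  exact isDefinedOver_zeroLocus _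

theorem aleph0_le_trdeg_complex {F : IntermediateField ℚ ℂ} {r : ℕ}
    (hr : Algebra.trdeg ℚ F = r) : Cardinal.aleph0 ≤ Algebra.trdeg F ℂ := by
  have h1 : Cardinal.aleph0 ≤ Algebra.trdeg ℚ ℂ := by
    obtain ⟨s, hs⟩ := exists_isTranscendenceBasis ℚ ℂ
    rw [← hs.cardinalMk_eq_trdeg]
    by_contra hlt
    have h2 := IsAlgClosed.cardinal_le_max_transcendence_basis' (fun x : s => (x : ℂ)) hs
    rw [Cardinal.mk_complex] at h2
    refine absurd h2 (not_le.2 (lt_of_le_of_lt ?_ Cardinal.aleph0_lt_continuum))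
    simpa using (not_le.1 hlt).le
  by_contra hlt
  rw [← trdeg_add_eq ℚ F (A := ℂ), hr] at h1
  exact absurd h1 (not_le.2 (Cardinal.add_lt_aleph0 Cardinal.natCast_lt_aleph0 (not_le.1 hlt)))

/-- F(α) has transcendence degree at least d over ℚ, and the degree is additive in the tower ℚ ⊆ F ⊆
F(α). -/
theorem natCast_le_trdeg_adjoin_add {F : IntermediateField ℚ ℂ} {d : ℕ} {α : Fin d → ℂ}
    (hα : AlgebraicIndependent ℚ α) :
    (d : Cardinal) ≤ Algebra.trdeg F (IntermediateField.adjoin F (Set.range α)) +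
      Algebra.trdeg ℚ F := by
  set B := IntermediateField.adjoin F (Set.range α)
  have : FaithfulSMul F B :=
    (faithfulSMul_iff_algebraMap_injective F B).2 (algebraMap F B).injective
  rw [add_comm, trdeg_add_eq ℚ F (A := B)]
  let β : Fin d → B := fun i => ⟨α i, IntermediateField.subset_adjoin _ _ ⟨i, rfl⟩⟩
  have hβ : AlgebraicIndependent ℚ β :=
    AlgebraicIndependent.of_comp (B.val.restrictScalars ℚ) hα
  simpa using hβ.cardinalMk_le_trdeg

theorem exists_isGenericPointOver_modifiedPartialSum (a : ℕ → ℤ) {n m : ℕ}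
    {Φ : Finset (MvPolynomial ((Fin n ⊕ Fin n) ⊕ Fin m) ℚ)} {z : Fin m → ℂ}
    (hz : ConditionTheta Φ z) {r : ℕ} (hr : Algebra.trdeg ℚ (paramField z) = r)
    (k : ℕ) {d : ℕ} (hd : n * (r + 2) ≤ d) {g : ℂ → ℂ} (hg : IsGenericPolynomial d g) :
    ∃ x : Fin n → ℂ, IsGenericPointOver (paramField z) (paramVariety Φ z)
      (Sum.elim x (fun i => modifiedPartialSum a k g (x i))) := by
  obtain ⟨α, hα, rfl⟩ := hg
  set F := paramField z
  have hdef := isDefinedOver_paramVariety Φ z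
  let g₀ : Polynomial F := ∑ i ∈ Finset.Icc 1 k, Polynomial.C ((a i : F)⁻¹) * Polynomial.X ^ i
  let h : Polynomial ℂ := ∑ j : Fin d, Polynomial.monomial j (α j)
  have hcoeff : ∀ j : Fin d, h.coeff j = α j := by
    intro j
    simp [h, Polynomial.finsetSum_coeff, Polynomial.coeff_monomial, Fin.val_inj]
  have hdeg : h.degree < d := by
    rw [Polynomial.degree_lt_iff_coeff_zero]
    intro i hi
    simp only [h, Polynomial.finsetSum_coeff, Polynomial.coeff_monomial]
    exact Finset.sum_eq_zero fun j _ => if_neg (by omega)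
  -- The exponent is k + 1 because g has no constant term: g = X·h.
  obtain ⟨v, hv, hveq⟩ := exists_isGenericOver_of_le_trdeg_coeff hz.1 hz.2 r
    (aleph0_le_trdeg_complex hr) hdef g₀ (q := Polynomial.X ^ (k + 1))
    (pow_ne_zero _ Polynomial.X_ne_zero) hd hdeg (by
      rw [funext hcoeff, ← hr]
      exact natCast_le_trdeg_adjoin_add hα)
  have hvx : Sum.elim (fun i => v (Sum.inl i))
      (fun i => modifiedPartialSum a k (polyOfCoeffs α) (v (Sum.inl i))) = v := by
    funext i
    cases i with
    | inl i => rfl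
    | inr i =>
      rw [hveq i]
      simp only [Sum.elim_inr, modifiedPartialSum, liouvillePartialSum, polyOfCoeffs, g₀, h,
        map_sum, map_mul, map_pow, Polynomial.aeval_X, Polynomial.aeval_C,
        Polynomial.eval_finsetSum, Polynomial.eval_monomial, Finset.mul_sum, map_inv₀, map_intCast]
      congr 1
      · exact Finset.sum_congr rfl fun j _ => by ring
      · exact Finset.sum_congr rfl fun j _ => by ring
  refine ⟨fun i => v (Sum.inl i), ?_⟩
  rw [hvx]
  exact ⟨hv.mem hdef, hv.trdeg_eq hz.1.irreducible hdef hz.1.dim_eq⟩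

end GenericPolynomial

theorem proposition4 (a : ℕ → ℤ) (ha : IsLiouvilleSequence a) (n m : ℕ)
    (Φ : Finset (MvPolynomial ((Fin n ⊕ Fin n) ⊕ Fin m) ℚ)) (z : Fin m → ℂ)
    (hz : ConditionTheta Φ z) (r : ℕ) (hr : Algebra.trdeg ℚ (paramField z) = r)
    (k d : ℕ) (hd : n * (n * r + n + r + 1) ≤ d) (g : ℂ → ℂ) (hg : IsGenericPolynomial d g) :
    (∃ x : Fin n → ℂ, IsGenericPointOver (paramField z) (paramVariety Φ z)
      (Sum.elim x (fun i => modifiedPartialSum a k g (x i)))) ∧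
    ∀ x : Fin n → ℂ, IsGenericPointOver (paramField z) (paramVariety Φ z)
      (Sum.elim x (fun i => modifiedPartialSum a k g (x i))) →
      (∀ i, x i ≠ 0) ∧ ∀ i j, i ≠ j → x i ≠ x j := by
  refine ⟨exists_isGenericPointOver_modifiedPartialSum a hz hr k (le_trans ?_ hd) hg, ?_⟩
  · rcases Nat.eq_zero_or_pos n with rfl | hn
    · simp
    -- For n ≥ 1, r + 2 ≤ nr + n + r + 1.
    · exact Nat.mul_le_mul_left n (by nlinarith)
  · rintro x ⟨hx, htr⟩
    have hv := isGenericOver_of_trdeg_eq hz.1.irreducible (isDefinedOver_paramVariety Φ z)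
      hz.1.dim_eq hx htr
    refine ⟨fun i h0 => ?_, fun i j hij => hv.apply_ne (hz.1.not_subset_diag i j hij)⟩
    have ht := hv.transcendental hz.1.irreducible (hz.1.not_subset_const i)
    rw [Sum.elim_inl, h0] at ht
    exact ht isAlgebraic_zero

end
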